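/- Let $\mathrm{Sym}(n)$ be the space of symmetric real $n\times n$ matrices with the Frobenius inner product $\langle\cdot,\cdot\rangle$, and let $\mathcal S^n_{++}\subset\mathrm{Sym}(n)$ be the manifold of symmetric positive definite (SPD) matrices, with $T_P\mathcal S^n_{++}\cong\mathrm{Sym}(n)$. For a Riemannian metric $g$ on $\mathcal S^n_{++}$ with geodesic distance $d$ and Riemannian logarithm $\mathrm{Log}$, put $\tilde H_{A,P}=\{S\in\mathcal S^n_{++}: g_P(\mathrm{Log}_P S,A)=0\}$ and $d(S,\tilde H_{A,P})=\inf_{Q\in\tilde H_{A,P}}d(S,Q)$. Given $C$ classes with parameters $P_k\in\mathcal S^n_{++}$ and $\tilde A_k\in T_I\mathcal S^n_{++}\cong\mathrm{Sym}(n)$, let $A_k=\Gamma_{I\to P_k}(\tilde A_k)$ be the parallel transport of $\tilde A_k$ along the geodesic from $I$ to $P_k$. The SPD multinomial logistic regression (SPD MLR) under $g$ is the probability vector $(p(y=k\mid S))_{k=1}^C$ with $$p(y=k\mid S)\ \propto\ \exp\Big(\operatorname{sign}\big(g_{P_k}(A_k,\mathrm{Log}_{P_k}S)\big)\,\|A_k\|_{P_k}\,d(S,\tilde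 H_{A_k,P_k})\Big),\qquad S\in\mathcal S^n_{++}.$$ Notation: $\log$ is the matrix logarithm; $\mathrm{Chol}(P)$ is the Cholesky factor of $P$, i.e. the lower triangular $L$ with positive diagonal and $LL^\top=P$; $\lfloor M\rfloor$ is the strictly lower triangular part of $M$; $\mathbb D(M)$ is the diagonal matrix with the diagonal of $M$; $\mathrm{Dlog}(M)$ is the diagonal matrix of the logarithms of the diagonal entries of $M$; $f_{*,P}$ is the differential of $f$ at $P$. (1) Let $\alpha,\beta\in\mathbb R$ with $\min(\alpha,\alpha+n\beta)>0$, and $\langle V,W\rangle^{(\alpha,\beta)}=\alpha\langle V,W\rangle+\beta\,\mathrm{tr}(V)\,\mathrm{tr}(W)$. The $(\alpha,\beta)$-Log-Euclidean metric $g_P(V,W)=\langle\log_{*,P}V,\log_{*,P}W\rangle^{(\alpha,\beta)}$ is a Riemannian metric on $\mathcal S^n_{++}$ for which any two points are joined by a unique geodesic (so that $\mathrm{Log}$ and $\Gamma$ are everywhere well defined), and the SPD MLR under it is $$p(y=k\mid S)\ \propto\ \exp\big[\langle\log S-\log P_k,\tilde A_k\rangle^{(\alpha,\beta)}\big].$$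 (2) Let $\theta\ne0$. The Log-Cholesky metric is $g^{LC}_P(V,W)=\sum_{i>j}\tilde V_{ij}\tilde W_{ij}+\sum_j\tilde V_{jj}\tilde W_{jj}L_{jj}^{-2}$, where $L=\mathrm{Chol}(P)$, $\tilde V=\mathrm{Chol}_{*,P}(V)$, $\tilde W=\mathrm{Chol}_{*,P}(W)$. The $\theta$-Log-Cholesky metric, i.e. $\frac1{\theta^2}$ times the pullback of $g^{LC}$ by the matrix power $S\mapsto S^\theta$, is a Riemannian metric on $\mathcal S^n_{++}$ for which any two points are joined by a unique geodesic, and the SPD MLR under it is $$p(y=k\mid S)\ \propto\ \exp\Big[\tfrac1\theta\langle X,Y\rangle\Big],$$ $$X=\lfloor\tilde K\rfloor-\lfloor\tilde L_k\rfloor+\big[\mathrm{Dlog}(\mathbb D(\tilde K))-\mathrm{Dlog}(\mathbb D(\tilde L_k))\big],\qquad Y=\lfloor\tilde A_k\rfloor+\tfrac12\mathbb D(\tilde A_k),$$ where $\tilde K=\mathrm{Chol}(S^\theta)$ and $\tilde L_k=\mathrm{Chol}(P_k^\theta)$. -/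

import Mathlib

open Set
open scoped Matrix ContDiff

/-! ## Riemannian geometry of an open subset of a vector space

An open subset `U` of a finite-dimensional real vector space `E` is a manifold with a single
global chart, and each of its tangent spaces is `E`. A Riemannian metric on `U` is a map `g` that
assigns a bilinear form on `E` to each point; only its values on `U` matter. -/

namespace OpenRiem

noncomputable section

variable {E : Type*} [NormedAddCommGroup E] [NormedSpace ℝ E]
variable {F : Type*} [NormedAddCommGroup F] [NormedSpace ℝ F]

/-- `U` is open and `g` is a smooth Riemannian metric on it. -/
structure IsRiemannianMetric (U : Set E) (g : E → LinearMap.BilinForm ℝ E) : Prop where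
  isOpen : IsOpen U
  symm : ∀ P ∈ U, ∀ V W : E, g P V W = g P W V
  posDef : ∀ P ∈ U, ∀ V : E, V ≠ 0 → 0 < g P V V
  smooth : ∀ V W : E, ContDiffOn ℝ ∞ (fun P => g P V W) U

/-- The pullback of a metric: `(f^* g)_P (V, W) = g_{f P} (f_{*,P} V, f_{*,P} W)`. -/
def pullback (f : E → F) (g : F → LinearMap.BilinForm ℝ F) : E → LinearMap.BilinForm ℝ E :=
  fun P => (g (f P)).comp (fderiv ℝ f P : E →ₗ[ℝ] F) (fderiv ℝ f P : E →ₗ[ℝ] F)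

/-- The Christoffel symbols of the first kind of the Levi-Civita connection, by the Koszul formula:
`christoffel g P X V W = g_P (∇_X V, W)` for constant vector fields `X`, `V`, `W`. -/
def christoffel (g : E → LinearMap.BilinForm ℝ E) (P X V W : E) : ℝ :=
  (fderiv ℝ (fun Q => g Q V W) P X + fderiv ℝ (fun Q => g Q X W) P V
    - fderiv ℝ (fun Q => g Q X V) P W) / 2

/-- The vector field `X` along the curve `γ` is parallel for the Levi-Civita connection of `g`
at all times in `J`: its covariant derivative along `γ`, which is `X' + Γ(γ', X)`, vanishes. -/
def IsParallelOn (g : E → LinearMap.BilinForm ℝ E) (J : Set ℝ) (γ X : ℝ → E) : Prop :=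
  ∀ t ∈ J, ∀ W : E, g (γ t) (deriv X t) W + christoffel g (γ t) (deriv γ t) (X t) W = 0

/-- `γ` is, on the open set of times `J`, a smooth geodesic of `(U, g)`. -/
structure IsGeodesicOn (U : Set E) (g : E → LinearMap.BilinForm ℝ E) (J : Set ℝ) (γ : ℝ → E) :
    Prop where
  smooth : ContDiffOn ℝ ∞ γ J
  mapsTo : MapsTo γ J U
  parallel : IsParallelOn g J γ (deriv γ)

/-- `exp_P V` is defined and equals `Q`: the geodesic that starts at `P` with velocity `V` exists
up to time `1` and is then at `Q`. -/
def IsExp (U : Set E) (g : E → LinearMap.BilinForm ℝ E) (P V Q : E) : Prop :=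
  ∃ J : Set ℝ, IsOpen J ∧ Icc 0 1 ⊆ J ∧
    ∃ γ : ℝ → E, IsGeodesicOn U g J γ ∧ γ 0 = P ∧ deriv γ 0 = V ∧ γ 1 = Q

/-- The Riemannian logarithm `log_P Q`: the tangent vector `V` at `P` with `exp_P V = Q`. -/
def rieLog (U : Set E) (g : E → LinearMap.BilinForm ℝ E) (P Q : E) : E :=
  Classical.epsilon fun V => IsExp U g P V Q

/-- `W` is obtained from `V` by parallel transport along a geodesic from `P` to `Q`. -/
def IsTransport (U : Set E) (g : E → LinearMap.BilinForm ℝ E) (P Q V W : E) : Prop :=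
  ∃ J : Set ℝ, IsOpen J ∧ Icc 0 1 ⊆ J ∧
    ∃ γ : ℝ → E, IsGeodesicOn U g J γ ∧ γ 0 = P ∧ γ 1 = Q ∧
      ∃ X : ℝ → E, ContDiffOn ℝ ∞ X J ∧ IsParallelOn g J γ X ∧ X 0 = V ∧ X 1 = W

/-- The parallel transport `Γ_{P → Q} V` along the geodesic from `P` to `Q`. -/
def transport (U : Set E) (g : E → LinearMap.BilinForm ℝ E) (P Q V : E) : E :=
  Classical.epsilon fun W => IsTransport U g P Q V W

/-- Any two points are joined by exactly one geodesic, so that the Riemannian logarithm and the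
parallel transport are everywhere defined and unambiguous. -/
structure HasLogAndTransport (U : Set E) (g : E → LinearMap.BilinForm ℝ E) : Prop where
  log : ∀ P ∈ U, ∀ Q ∈ U, ∃! V : E, IsExp U g P V Q
  transport : ∀ P ∈ U, ∀ Q ∈ U, ∀ V : E, ∃! W : E, IsTransport U g P Q V W

/-- The length of the curve `γ` on `[0, 1]`. -/
def curveLength (g : E → LinearMap.BilinForm ℝ E) (γ : ℝ → E) : ℝ :=
  ∫ t in (0 : ℝ)..1, √(g (γ t) (derivWithin γ (Icc 0 1) t) (derivWithin γ (Icc 0 1) t))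

/-- The geodesic distance: the infimum of the lengths of the `C¹` curves in `U` from `P` to `Q`. -/
def rieDist (U : Set E) (g : E → LinearMap.BilinForm ℝ E) (P Q : E) : ℝ :=
  sInf {l : ℝ | ∃ γ : ℝ → E, ContDiffOn ℝ 1 γ (Icc 0 1) ∧ MapsTo γ (Icc 0 1) U ∧
    γ 0 = P ∧ γ 1 = Q ∧ l = curveLength g γ}

/-- The hyperplane with shift `P` and normal vector `A`: `{S | g_P (log_P S, A) = 0}`. -/
def hyperplane (U : Set E) (g : E → LinearMap.BilinForm ℝ E) (P A : E) : Set E :=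
  {S | S ∈ U ∧ g P (rieLog U g P S) A = 0}

/-- The margin distance from `S` to the set `H`: `inf_{Q ∈ H} d(S, Q)`. -/
def marginDist (U : Set E) (g : E → LinearMap.BilinForm ℝ E) (S : E) (H : Set E) : ℝ :=
  sInf ((fun Q => rieDist U g S Q) '' H)

/-- The score of a class: `sign(⟨A, log_P S⟩_P) ‖A‖_P d(S, H_{A,P})`. -/
def score (U : Set E) (g : E → LinearMap.BilinForm ℝ E) (P A S : E) : ℝ :=
  Real.sign (g P A (rieLog U g P S)) * √(g P A A) * marginDist U g S (hyperplane U g P A)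

end

end OpenRiem

attribute [local instance] Matrix.frobeniusNormedAddCommGroup
attribute [local instance] Matrix.frobeniusNormedSpace

noncomputable section

/-- The probability vector on `C` classes that is proportional to `exp (s k)`. -/
def softmax {C : ℕ} (s : Fin C → ℝ) (k : Fin C) : ℝ :=
  Real.exp (s k) / ∑ j, Real.exp (s j)

/-- Riemannian multinomial logistic regression on `(U, g)` with shifts `P k` and normal vectors
`A k` in the tangent spaces at `P k`: the probability `p(y = k | S)`. -/
def rieMLR {E : Type*} [NormedAddCommGroup E] [NormedSpace ℝ E] (U : Set E)
    (g : E → LinearMap.BilinForm ℝ E) {C : ℕ} (P A : Fin C → E) (S : E) : Fin C → ℝ :=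
  softmax fun k => OpenRiem.score U g (P k) (A k) S

/-! ## The manifold of symmetric positive definite matrices -/

/-- The space of symmetric real `n × n` matrices. -/
def SymMat (n : ℕ) : Submodule ℝ (Matrix (Fin n) (Fin n) ℝ) where
  carrier := {A | A.IsSymm}
  add_mem' hA hB := hA.add hB
  zero_mem' := Matrix.isSymm_zero
  smul_mem' c _ hA := hA.smul c

/-- The symmetric positive definite matrices. -/
def SPD (n : ℕ) : Set (SymMat n) := {S | (S : Matrix (Fin n) (Fin n) ℝ).PosDef}

/-- The identity matrix. -/
def symOne (n : ℕ) : SymMat n := ⟨1, Matrix.isSymm_one⟩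

/-- The symmetric matrix `f(S)`, where `f` acts on the eigenvalues of `S`. -/
def symFun {n : ℕ} (f : ℝ → ℝ) (S : SymMat n) : SymMat n :=
  ⟨cfc f (S : Matrix (Fin n) (Fin n) ℝ), by
    have h : IsSelfAdjoint (cfc f (S : Matrix (Fin n) (Fin n) ℝ)) := cfc_predicate _ _
    have h2 := h.star_eq
    rw [Matrix.star_eq_conjTranspose, Matrix.conjTranspose_eq_transpose_of_trivial] at h2
    exact h2⟩

/-- The matrix logarithm. -/
def mlog {n : ℕ} (S : SymMat n) : SymMat n := symFun Real.log S

/-- The matrix power `S ^ θ`. -/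
def mpow {n : ℕ} (θ : ℝ) (S : SymMat n) : SymMat n := symFun (fun x => x ^ θ) S

/-- The Cholesky factor of `P`: the lower triangular matrix `L` with positive diagonal entries and
`L Lᵀ = P`. -/
def chol {n : ℕ} (P : SymMat n) : Matrix (Fin n) (Fin n) ℝ :=
  Classical.epsilon fun L => (∀ i j, i < j → L i j = 0) ∧ (∀ i, 0 < L i i) ∧
    L * Lᵀ = (P : Matrix (Fin n) (Fin n) ℝ)

/-- The strictly lower triangular part of a square matrix. -/
def strictLower {n : ℕ} (M : Matrix (Fin n) (Fin n) ℝ) : Matrix (Fin n) (Fin n) ℝ :=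
  Matrix.of fun i j => if j < i then M i j else 0

/-- The diagonal part of a square matrix. -/
def diagPart {n : ℕ} (M : Matrix (Fin n) (Fin n) ℝ) : Matrix (Fin n) (Fin n) ℝ :=
  Matrix.diagonal fun i => M i i

/-- The diagonal matrix of the logarithms of the diagonal entries. -/
def dlog {n : ℕ} (M : Matrix (Fin n) (Fin n) ℝ) : Matrix (Fin n) (Fin n) ℝ :=
  Matrix.diagonal fun i => Real.log (M i i)

/-- The standard Frobenius inner product. -/
def frob {n : ℕ} (V W : Matrix (Fin n) (Fin n) ℝ) : ℝ := ∑ i, ∑ j, V i j * W i j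

/-- The inner product `α ⟨V, W⟩ + β tr(V) tr(W)` on symmetric matrices. -/
def innerAB (n : ℕ) (α β : ℝ) : LinearMap.BilinForm ℝ (SymMat n) :=
  LinearMap.mk₂ ℝ
    (fun V W => α * frob (V : Matrix (Fin n) (Fin n) ℝ) W
      + β * (Matrix.trace (V : Matrix (Fin n) (Fin n) ℝ)
        * Matrix.trace (W : Matrix (Fin n) (Fin n) ℝ)))
    (by intro V V' W
        simp only [frob, Submodule.coe_add, Matrix.add_apply, Matrix.trace_add, add_mul,
          Finset.sum_add_distrib]
        ring)
    (by intro c V W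
        simp only [frob, Submodule.coe_smul, Matrix.smul_apply, Matrix.trace_smul, smul_eq_mul,
          mul_assoc, ← Finset.mul_sum]
        ring)
    (by intro V W W'
        simp only [frob, Submodule.coe_add, Matrix.add_apply, Matrix.trace_add, mul_add,
          Finset.sum_add_distrib]
        ring)
    (by intro c V W
        simp only [frob, Submodule.coe_smul, Matrix.smul_apply, Matrix.trace_smul, smul_eq_mul,
          mul_left_comm _ c, ← Finset.mul_sum]
        ring)

/-- The bilinear form `∑_{i > j} X i j * Y i j + ∑_j X j j * Y j j * (L j j)⁻²`, which at a
Cholesky factor `L` is the log-Cholesky metric on lower triangular matrices. -/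
def lcForm {n : ℕ} (L : Matrix (Fin n) (Fin n) ℝ) :
    LinearMap.BilinForm ℝ (Matrix (Fin n) (Fin n) ℝ) :=
  LinearMap.mk₂ ℝ
    (fun X Y => (∑ i, ∑ j, if j < i then X i j * Y i j else 0)
      + ∑ j, X j j * Y j j * ((L j j) ^ 2)⁻¹)
    (by intro X X' Y
        simp only [Matrix.add_apply, add_mul, ite_add_zero, Finset.sum_add_distrib]
        ring)
    (by intro c X Y
        simp only [Matrix.smul_apply, smul_eq_mul, mul_assoc, ← mul_ite_zero,
          ← Finset.mul_sum]
        ring)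
    (by intro X Y Y'
        simp only [Matrix.add_apply, mul_add, add_mul, ite_add_zero, Finset.sum_add_distrib]
        ring)
    (by intro c X Y
        simp only [Matrix.smul_apply, smul_eq_mul, mul_assoc, mul_left_comm _ c,
          ← mul_ite_zero, ← Finset.mul_sum]
        ring)

/-- The `(α, β)`-Log-Euclidean metric: `g_P(V, W) = ⟨log_{*,P} V, log_{*,P} W⟩^{(α,β)}`. -/
def lemMetric (n : ℕ) (α β : ℝ) : SymMat n → LinearMap.BilinForm ℝ (SymMat n) :=
  OpenRiem.pullback mlog fun _ => innerAB n α β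

/-- The Log-Cholesky metric: with `L = chol P` and `V' = chol_{*,P} V`, `W' = chol_{*,P} W`,
`g_P(V, W) = ∑_{i > j} V' i j * W' i j + ∑_j V' j j * W' j j * (L j j)⁻²`. -/
def lcMetric (n : ℕ) : SymMat n → LinearMap.BilinForm ℝ (SymMat n) :=
  OpenRiem.pullback chol lcForm

/-- The `θ`-deformed Log-Cholesky metric: the pullback of the Log-Cholesky metric by the matrix
power `S ↦ S ^ θ`, scaled by `1 / θ ^ 2`. -/
def lcMetricDeformed (n : ℕ) (θ : ℝ) : SymMat n → LinearMap.BilinForm ℝ (SymMat n) :=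
  fun P => (1 / θ ^ 2) • OpenRiem.pullback (mpow θ) (lcMetric n) P

/-- The matrix `X = ⌊K⌋ - ⌊L⌋ + [dlog(D(K)) - dlog(D(L))]`, where `K = chol(S ^ θ)` and
`L = chol(P ^ θ)`. -/
def lcmX {n : ℕ} (θ : ℝ) (S P : SymMat n) : Matrix (Fin n) (Fin n) ℝ :=
  strictLower (chol (mpow θ S)) - strictLower (chol (mpow θ P))
    + (dlog (diagPart (chol (mpow θ S))) - dlog (diagPart (chol (mpow θ P))))

/-- The matrix `Y = ⌊A⌋ + (1/2) D(A)`. -/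
def lcmY {n : ℕ} (A : SymMat n) : Matrix (Fin n) (Fin n) ℝ :=
  strictLower (A : Matrix (Fin n) (Fin n) ℝ)
    + (1 / 2 : ℝ) • diagPart (A : Matrix (Fin n) (Fin n) ℝ)

end

/-! Both metrics are flat: each is the pullback of a constant inner product `b` under a global chart
`φ` from the positive definite matrices onto a vector space. The charts are `log` with values in the
symmetric matrices, and `S ↦ ⌊L⌋ + Dlog L`, `L = Chol(S ^ θ)`, with values in the lower triangular
matrices. The logarithm of the diagonal absorbs the weights `L_jj⁻²`.

In such a chart the covariant derivative is the ordinary derivative. Geodesics are straight lines,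
parallel fields are constant, and the distance is the norm of a difference
(`FlatChart.christoffel_eq`, `FlatChart.isParallelOn_iff`, `FlatChart.rieDist_eq`). The set
`H_{A,P}` becomes the affine hyperplane through `φ P` orthogonal to `φ_{*,P} A` (everything, if `A =
0`), so the distance formula from a point to a hyperplane turns the score into `b (φ S - φ P)
(φ_{*,P} A)`. When `A` is transported from `I`, its image under the differential is the same at `P`
as at `I`, so only `φ_{*,I}` is needed (`FlatChart.score_transport`). It is the identity for `log`,
and `θ (⌊A⌋ + D(A)/2)` for the second chart; with the factor `1 / θ²` this gives `1 / θ`.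

The remaining work is the smoothness of the charts. Their inverses are explicit smooth maps, so by
the inverse function theorem it suffices that the differentials of the inverses are injective
(`fderiv_symExp_injective`, `fderiv_cholInv_injective`). -/

namespace OpenRiem

open Topology

noncomputable section

variable {E : Type*} [NormedAddCommGroup E] [NormedSpace ℝ E]
variable {F : Type*} [NormedAddCommGroup F] [NormedSpace ℝ F]

/-- `φ` is a global chart of `U` onto a vector space, with inverse `ψ`, in which the metric `g` is
the constant inner product `b`. -/
structure FlatChart (U : Set E) (g : E → LinearMap.BilinForm ℝ E) (φ : E → F) (ψ : F → E)
    (b : LinearMap.BilinForm ℝ F) : Prop where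
  isOpen : IsOpen U
  contDiffOn : ContDiffOn ℝ ∞ φ U
  contDiff_inv : ContDiff ℝ ∞ ψ
  inv_mem : ∀ x, ψ x ∈ U
  left_inv : ∀ P ∈ U, ψ (φ P) = P
  right_inv : ∀ x, φ (ψ x) = x
  symm : ∀ x y, b x y = b y x
  posDef : ∀ x, x ≠ 0 → 0 < b x x
  metric : ∀ P ∈ U, ∀ V W, g P V W = b (fderiv ℝ φ P V) (fderiv ℝ φ P W)

/-! ### Calculus in a flat chart -/

namespace FlatChart

variable {U : Set E} {g : E → LinearMap.BilinForm ℝ E} {φ : E → F} {ψ : F → E}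
  {b : LinearMap.BilinForm ℝ F}

theorem contDiffAt (h : FlatChart U g φ ψ b) {P : E} (hP : P ∈ U) : ContDiffAt ℝ ∞ φ P :=
  h.contDiffOn.contDiffAt (h.isOpen.mem_nhds hP)

theorem hasFDerivAt (h : FlatChart U g φ ψ b) {P : E} (hP : P ∈ U) :
    HasFDerivAt φ (fderiv ℝ φ P) P :=
  ((h.contDiffAt hP).differentiableAt (by simp)).hasFDerivAt

theorem hasFDerivAt_inv (h : FlatChart U g φ ψ b) (x : F) : HasFDerivAt ψ (fderiv ℝ ψ x) x :=
  (h.contDiff_inv.contDiffAt.differentiableAt (by simp)).hasFDerivAt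

theorem contDiffOn_fderiv (h : FlatChart U g φ ψ b) : ContDiffOn ℝ ∞ (fderiv ℝ φ) U :=
  h.contDiffOn.fderiv_of_isOpen h.isOpen (by simp)

theorem hasFDerivAt_fderiv (h : FlatChart U g φ ψ b) {P : E} (hP : P ∈ U) :
    HasFDerivAt (fderiv ℝ φ) (fderiv ℝ (fderiv ℝ φ) P) P :=
  ((h.contDiffOn_fderiv.contDiffAt (h.isOpen.mem_nhds hP)).differentiableAt (by simp)).hasFDerivAt

theorem fderiv_fderiv_inv (h : FlatChart U g φ ψ b) {P : E} (hP : P ∈ U) (v : F) :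
    fderiv ℝ φ P (fderiv ℝ ψ (φ P) v) = v := by
  have h1 : HasFDerivAt φ (fderiv ℝ φ P) (ψ (φ P)) := by
    rw [h.left_inv P hP]; exact h.hasFDerivAt hP
  have h2 := h1.comp (φ P) (h.hasFDerivAt_inv (φ P))
  have h3 : φ ∘ ψ = id := funext h.right_inv
  rw [h3] at h2
  exact congrArg (fun T : F →L[ℝ] F => T v) (h2.unique (hasFDerivAt_id _))

theorem fderiv_inv_fderiv (h : FlatChart U g φ ψ b) {P : E} (hP : P ∈ U) (V : E) :
    fderiv ℝ ψ (φ P) (fderiv ℝ φ P V) = V := by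
  have h2 := (h.hasFDerivAt_inv (φ P)).comp P (h.hasFDerivAt hP)
  have h3 : id =ᶠ[𝓝 P] ψ ∘ φ := by
    filter_upwards [h.isOpen.mem_nhds hP] with Q hQ using (h.left_inv Q hQ).symm
  exact congrArg (fun T : E →L[ℝ] E => T V)
    ((h2.congr_of_eventuallyEq h3).unique (hasFDerivAt_id _))

theorem fderiv_injective (h : FlatChart U g φ ψ b) {P : E} (hP : P ∈ U) :
    Function.Injective (fderiv ℝ φ P) :=
  Function.LeftInverse.injective (h.fderiv_inv_fderiv hP)

theorem eq_zero_of_form (h : FlatChart U g φ ψ b) {x : F} (hx : b x x = 0) : x = 0 := by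
  by_contra h0
  exact (h.posDef x h0).ne' hx

theorem form_nonneg (h : FlatChart U g φ ψ b) (x : F) : 0 ≤ b x x := by
  by_cases hx : x = 0
  · simp [hx]
  · exact (h.posDef x hx).le

theorem form_sq_le (h : FlatChart U g φ ψ b) (x y : F) : (b x y) ^ 2 ≤ b x x * b y y := by
  have := b.apply_mul_apply_le_of_forall_zero_le h.form_nonneg x y
  rwa [h.symm y x, ← sq] at this

theorem abs_form_le (h : FlatChart U g φ ψ b) (x y : F) : |b x y| ≤ √(b x x) * √(b y y) := by
  rw [← Real.sqrt_mul (h.form_nonneg x), ← Real.sqrt_sq_eq_abs]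
  exact Real.sqrt_le_sqrt (h.form_sq_le x y)

/-- Product rule; by `christoffel_eq` below, the second-derivative term is the Christoffel term read
in the chart. -/
theorem hasDerivAt_fderiv_apply (h : FlatChart U g φ ψ b) {γ X : ℝ → E} {t : ℝ}
    (hγ : DifferentiableAt ℝ γ t) (hU : γ t ∈ U) (hX : DifferentiableAt ℝ X t) :
    HasDerivAt (fun s => fderiv ℝ φ (γ s) (X s))
      (fderiv ℝ φ (γ t) (deriv X t) + fderiv ℝ (fderiv ℝ φ) (γ t) (deriv γ t) (X t)) t := by
  have h1 := (h.hasFDerivAt_fderiv hU).comp_hasDerivAt t hγ.hasDerivAt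
  have := h1.clm_apply hX.hasDerivAt
  rw [add_comm]
  exact this

theorem deriv_line (h : FlatChart U g φ ψ b) (x v : F) :
    deriv (fun t : ℝ => ψ (x + t • v)) 0 = fderiv ℝ ψ x v := by
  have h4 : HasDerivAt (fun t : ℝ => x + t • v) v 0 := by
    simpa using ((hasDerivAt_id (0 : ℝ)).smul_const v).const_add x
  have h5 : HasFDerivAt ψ (fderiv ℝ ψ x) (x + (0 : ℝ) • v) := by
    simpa using h.hasFDerivAt_inv x
  exact (h5.comp_hasDerivAt (0 : ℝ) h4).deriv

/-- Serves twice: with `v = 0` for parallel fields, and with `v` the constant velocity for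
geodesics. Only times in `[0, 1]` are concerned, since `J` need not be connected. -/
theorem apply_one_eq_of_hasDerivAt {f : ℝ → F} {v : F} {J : Set ℝ} (hJ : Icc (0 : ℝ) 1 ⊆ J)
    (hf : ∀ t ∈ J, HasDerivAt f v t) : ∀ t ∈ Icc (0 : ℝ) 1, f t = f 0 + t • v := by
  intro t ht
  have h1 : ∀ s ∈ Icc (0 : ℝ) 1, HasDerivAt (fun s => f s - s • v) 0 s := fun s hs => by
    have := (hf s (hJ hs)).sub ((hasDerivAt_id s).smul_const v)
    rwa [one_smul, sub_self] at this
  have h2 := constant_of_has_deriv_right_zero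
    (fun s hs => (h1 s hs).continuousAt.continuousWithinAt)
    (fun s hs => (h1 s (Ico_subset_Icc_self hs)).hasDerivWithinAt) t ht
  simp only [zero_smul, sub_zero] at h2
  rw [← h2, sub_add_cancel]

theorem differentiableAt_of_contDiffOn {J : Set ℝ} (hJ : IsOpen J) {γ : ℝ → E}
    (hγ : ContDiffOn ℝ ∞ γ J) {t : ℝ} (ht : t ∈ J) :
    DifferentiableAt ℝ γ t ∧ DifferentiableAt ℝ (deriv γ) t :=
  ⟨(hγ.contDiffAt (hJ.mem_nhds ht)).differentiableAt (by simp),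
    ((hγ.deriv_of_isOpen (m := ∞) hJ (by simp)).contDiffAt (hJ.mem_nhds ht)).differentiableAt
      (by simp)⟩

/-! ### Connection, geodesics, transport and distance of a flat metric -/

variable [FiniteDimensional ℝ F]

theorem isRiemannianMetric (h : FlatChart U g φ ψ b) : IsRiemannianMetric U g where
  isOpen := h.isOpen
  symm P hP V W := by rw [h.metric P hP, h.metric P hP, h.symm]
  posDef P hP V hV := by
    rw [h.metric P hP]
    refine h.posDef _ fun h0 => hV (h.fderiv_injective hP ?_)
    rw [h0, map_zero]
  smooth V W := by
    have h1 : ContDiffOn ℝ ∞ (fun P => b.toContinuousBilinearMap (fderiv ℝ φ P V)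
        (fderiv ℝ φ P W)) U :=
      ((b.toContinuousBilinearMap.contDiff.comp_contDiffOn
        (h.contDiffOn_fderiv.clm_apply contDiffOn_const)).clm_apply
        (h.contDiffOn_fderiv.clm_apply contDiffOn_const))
    exact h1.congr fun P hP => h.metric P hP V W

theorem fderiv_metric (h : FlatChart U g φ ψ b) {P : E} (hP : P ∈ U) (X V W : E) :
    fderiv ℝ (fun Q => g Q V W) P X =
      b (fderiv ℝ (fderiv ℝ φ) P X V) (fderiv ℝ φ P W) +
        b (fderiv ℝ φ P V) (fderiv ℝ (fderiv ℝ φ) P X W) := by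
  have h1 : (fun Q => g Q V W) =ᶠ[𝓝 P] fun Q =>
      b.toContinuousBilinearMap (fderiv ℝ φ Q V) (fderiv ℝ φ Q W) := by
    filter_upwards [h.isOpen.mem_nhds hP] with Q hQ using h.metric Q hQ V W
  have hd : ∀ Y : E, HasFDerivAt (fun Q => fderiv ℝ φ Q Y)
      ((fderiv ℝ (fderiv ℝ φ) P).flip Y) P := fun Y => by
    have := (h.hasFDerivAt_fderiv hP).clm_apply (hasFDerivAt_const Y P)
    simpa using this
  rw [h1.fderiv_eq]
  have h2 := (b.toContinuousBilinearMap.hasFDerivAt_of_bilinear (hd V) (hd W)).fderiv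
  rw [h2]
  simp [LinearMap.toContinuousBilinearMap_apply, add_comm]

/-- The product rule yields six terms in the Koszul formula. As the second derivative of `φ` is
symmetric, four of them cancel in pairs and the other two are equal. -/
theorem christoffel_eq (h : FlatChart U g φ ψ b) {P : E} (hP : P ∈ U) (X V W : E) :
    christoffel g P X V W = b (fderiv ℝ (fderiv ℝ φ) P X V) (fderiv ℝ φ P W) := by
  have hs : IsSymmSndFDerivAt ℝ φ P :=
    (h.contDiffAt hP).isSymmSndFDerivAt (by
      rw [minSmoothness_of_isRCLikeNormedField]; exact ENat.LEInfty.out)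
  rw [christoffel, h.fderiv_metric hP, h.fderiv_metric hP, h.fderiv_metric hP, hs V X, hs W X,
    hs W V, h.symm (fderiv ℝ φ P X), h.symm (fderiv ℝ φ P V)]
  ring

/-- The differential of `φ` sends the covariant derivative of `X` to the derivative of `φ_* X`, and
pairing with all `W` detects whether it vanishes. -/
theorem isParallelOn_iff (h : FlatChart U g φ ψ b) {J : Set ℝ} {γ X : ℝ → E}
    (hγ : ∀ t ∈ J, DifferentiableAt ℝ γ t) (hU : MapsTo γ J U)
    (hX : ∀ t ∈ J, DifferentiableAt ℝ X t) :
    IsParallelOn g J γ X ↔ ∀ t ∈ J, HasDerivAt (fun s => fderiv ℝ φ (γ s) (X s)) 0 t := by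
  refine forall₂_congr fun t ht => ?_
  have hd := h.hasDerivAt_fderiv_apply (hγ t ht) (hU ht) (hX t ht)
  have key : ∀ W, g (γ t) (deriv X t) W + christoffel g (γ t) (deriv γ t) (X t) W =
      b (fderiv ℝ φ (γ t) (deriv X t) + fderiv ℝ (fderiv ℝ φ) (γ t) (deriv γ t) (X t))
        (fderiv ℝ φ (γ t) W) := fun W => by
    rw [h.metric _ (hU ht), h.christoffel_eq (hU ht), map_add, LinearMap.add_apply]
  simp only [key]
  constructor
  · intro h0
    -- The test vector is the one whose image under `φ_*` is the covariant derivative itself, so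
    -- positive definiteness applies.
    have h1 := h0 (fderiv ℝ ψ (φ (γ t)) (fderiv ℝ φ (γ t) (deriv X t) +
      fderiv ℝ (fderiv ℝ φ) (γ t) (deriv γ t) (X t)))
    rw [h.fderiv_fderiv_inv (hU ht)] at h1
    rwa [h.eq_zero_of_form h1] at hd
  · intro h0 W
    rw [hd.unique h0, map_zero, LinearMap.zero_apply]

/-- The curve which is a straight line in the chart. -/
theorem isGeodesicOn_line (h : FlatChart U g φ ψ b) (x v : F) :
    IsGeodesicOn U g univ (fun t : ℝ => ψ (x + t • v)) := by
  have hs : ContDiff ℝ ∞ (fun t : ℝ => ψ (x + t • v)) :=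
    h.contDiff_inv.comp (contDiff_const.add (contDiff_id.smul contDiff_const))
  have hm : MapsTo (fun t : ℝ => ψ (x + t • v)) univ U := fun t _ => h.inv_mem _
  have hd := fun t (ht : t ∈ univ) => differentiableAt_of_contDiffOn isOpen_univ hs.contDiffOn ht
  refine ⟨hs.contDiffOn, hm, ?_⟩
  rw [h.isParallelOn_iff (fun t ht => (hd t ht).1) hm (fun t ht => (hd t ht).2)]
  intro t _
  have h1 : (fun s : ℝ => fderiv ℝ φ (ψ (x + s • v)) (deriv (fun t : ℝ => ψ (x + t • v)) s)) =
      fun _ => v := funext fun s => by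
    have h2 := (h.hasFDerivAt (h.inv_mem (x + s • v))).comp_hasDerivAt s
      (hd s (mem_univ s)).1.hasDerivAt
    have h3 : φ ∘ (fun t : ℝ => ψ (x + t • v)) = fun t : ℝ => x + t • v :=
      funext fun t => h.right_inv _
    rw [h3] at h2
    have h4 : HasDerivAt (fun t : ℝ => x + t • v) v s := by
      simpa using ((hasDerivAt_id s).smul_const v).const_add x
    exact h2.unique h4
  rw [h1]
  exact hasDerivAt_const t v

/-- A geodesic has constant velocity in the chart, hence is a segment there, and its endpoints
determine its initial velocity. -/
theorem isExp_iff (h : FlatChart U g φ ψ b) {P Q : E} (hP : P ∈ U) (hQ : Q ∈ U) (V : E) :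
    IsExp U g P V Q ↔ V = fderiv ℝ ψ (φ P) (φ Q - φ P) := by
  constructor
  · rintro ⟨J, hJ, hI, γ, hγ, h0, hV, h1⟩
    have hd := fun t (ht : t ∈ J) => differentiableAt_of_contDiffOn hJ hγ.smooth ht
    have hp := (h.isParallelOn_iff (fun t ht => (hd t ht).1) hγ.mapsTo
      (fun t ht => (hd t ht).2)).1 hγ.parallel
    have hc : ∀ t ∈ Icc (0 : ℝ) 1, fderiv ℝ φ (γ t) (deriv γ t) = fderiv ℝ φ P V := by
      intro t ht
      have := apply_one_eq_of_hasDerivAt hI hp t ht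
      rwa [smul_zero, add_zero, h0, hV] at this
    have hl := apply_one_eq_of_hasDerivAt (f := φ ∘ γ) (J := Icc 0 1) subset_rfl
      (fun t ht => hc t ht ▸ (h.hasFDerivAt (hγ.mapsTo (hI ht))).comp_hasDerivAt t
        (hd t (hI ht)).1.hasDerivAt) 1 (by simp)
    simp only [Function.comp_apply, h0, h1, one_smul] at hl
    rw [hl, add_sub_cancel_left, h.fderiv_inv_fderiv hP]
  · rintro rfl
    refine ⟨univ, isOpen_univ, subset_univ _, _, h.isGeodesicOn_line (φ P) (φ Q - φ P), ?_, ?_, ?_⟩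
    · simp [h.left_inv P hP]
    · exact h.deriv_line _ _
    · simp [h.left_inv Q hQ]

/-- A parallel field is constant in the chart, whichever curve carries it: flatness makes transport
independent of the path. -/
theorem isTransport_iff (h : FlatChart U g φ ψ b) {P Q : E} (hP : P ∈ U) (hQ : Q ∈ U) (V W : E) :
    IsTransport U g P Q V W ↔ W = fderiv ℝ ψ (φ Q) (fderiv ℝ φ P V) := by
  constructor
  · rintro ⟨J, hJ, hI, γ, hγ, h0, h1, X, hX, hp, hX0, hX1⟩
    have hd := fun t (ht : t ∈ J) => differentiableAt_of_contDiffOn hJ hγ.smooth ht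
    have hdX := fun t (ht : t ∈ J) => differentiableAt_of_contDiffOn hJ hX ht
    rw [h.isParallelOn_iff (fun t ht => (hd t ht).1) hγ.mapsTo (fun t ht => (hdX t ht).1)] at hp
    have := apply_one_eq_of_hasDerivAt hI hp 1 (by simp)
    rw [smul_zero, add_zero, h0, hX0, h1, hX1] at this
    rw [← this, h.fderiv_inv_fderiv hQ]
  · rintro rfl
    have hg := h.isGeodesicOn_line (φ P) (φ Q - φ P)
    have hX : ContDiff ℝ ∞ (fun t : ℝ => fderiv ℝ ψ (φ P + t • (φ Q - φ P)) (fderiv ℝ φ P V)) :=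
      ((h.contDiff_inv.fderiv_right (m := ∞) (by simp)).comp
        (contDiff_const.add (contDiff_id.smul contDiff_const))).clm_apply contDiff_const
    refine ⟨univ, isOpen_univ, subset_univ _, _, hg, ?_, ?_, _, hX.contDiffOn, ?_, ?_, ?_⟩
    · simp [h.left_inv P hP]
    · simp [h.left_inv Q hQ]
    · rw [h.isParallelOn_iff
        (fun t ht => (differentiableAt_of_contDiffOn isOpen_univ hg.smooth ht).1) hg.mapsTo
        (fun t ht => (differentiableAt_of_contDiffOn isOpen_univ hX.contDiffOn ht).1)]
      intro t _
      have h1 : (fun s : ℝ => fderiv ℝ φ (ψ (φ P + s • (φ Q - φ P)))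
          (fderiv ℝ ψ (φ P + s • (φ Q - φ P)) (fderiv ℝ φ P V))) =
          fun _ => fderiv ℝ φ P V := funext fun s => by
        have := h.fderiv_fderiv_inv (h.inv_mem (φ P + s • (φ Q - φ P))) (fderiv ℝ φ P V)
        rwa [h.right_inv] at this
      rw [h1]
      exact hasDerivAt_const t _
    · simp [h.fderiv_inv_fderiv hP]
    · simp

theorem hasLogAndTransport (h : FlatChart U g φ ψ b) : HasLogAndTransport U g where
  log P hP Q hQ := by
    simp only [h.isExp_iff hP hQ]
    exact existsUnique_eq
  transport P hP Q hQ V := by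
    simp only [h.isTransport_iff hP hQ]
    exact existsUnique_eq

theorem rieLog_eq (h : FlatChart U g φ ψ b) {P Q : E} (hP : P ∈ U) (hQ : Q ∈ U) :
    rieLog U g P Q = fderiv ℝ ψ (φ P) (φ Q - φ P) := by
  have : IsExp U g P (rieLog U g P Q) Q :=
    Classical.epsilon_spec (p := fun V => IsExp U g P V Q) ⟨_, (h.isExp_iff hP hQ _).2 rfl⟩
  exact (h.isExp_iff hP hQ _).1 this

theorem transport_eq (h : FlatChart U g φ ψ b) {P Q : E} (hP : P ∈ U) (hQ : Q ∈ U) (V : E) :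
    transport U g P Q V = fderiv ℝ ψ (φ Q) (fderiv ℝ φ P V) := by
  have : IsTransport U g P Q V (transport U g P Q V) :=
    Classical.epsilon_spec (p := fun W => IsTransport U g P Q V W)
      ⟨_, (h.isTransport_iff hP hQ V _).2 rfl⟩
  exact (h.isTransport_iff hP hQ V _).1 this

/-- Calibration by the linear form `b c`, where `c` is the chord in the chart: its integral along
the velocity is `b c c`, and by Cauchy–Schwarz that is at most `√(b c c)` times the length. -/
theorem sqrt_form_le_curveLength (h : FlatChart U g φ ψ b) {γ : ℝ → E}
    (hγ : ContDiffOn ℝ 1 γ (Icc 0 1)) (hU : MapsTo γ (Icc 0 1) U) :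
    √(b (φ (γ 1) - φ (γ 0)) (φ (γ 1) - φ (γ 0))) ≤ curveLength g γ := by
  set c := φ (γ 1) - φ (γ 0) with hc
  set u : ℝ → F := fun t => fderiv ℝ φ (γ t) (derivWithin γ (Icc 0 1) t) with hu
  have hcu : ContinuousOn u (Icc 0 1) :=
    (h.contDiffOn_fderiv.continuousOn.comp hγ.continuousOn hU).clm_apply
      (hγ.continuousOn_derivWithin (uniqueDiffOn_Icc zero_lt_one) le_rfl)
  have hlen : curveLength g γ = ∫ t in (0 : ℝ)..1, √(b (u t) (u t)) := by
    refine intervalIntegral.integral_congr fun t ht => ?_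
    rw [uIcc_of_le zero_le_one] at ht
    simp only [h.metric _ (hU ht), hu]
  have hcb : ContinuousOn (fun t => b c (u t)) (Icc 0 1) :=
    (b.toContinuousBilinearMap c).continuous.comp_continuousOn hcu
  have hcs : ContinuousOn (fun t => √(b (u t) (u t))) (Icc 0 1) :=
    ((b.toContinuousBilinearMap.continuous.comp_continuousOn hcu).clm_apply hcu).sqrt
  have hI : ∫ t in (0 : ℝ)..1, b c (u t) = b c c := by
    have : b c c = b c (φ (γ 1)) - b c (φ (γ 0)) := by rw [← map_sub]
    rw [this]
    refine intervalIntegral.integral_eq_sub_of_hasDerivAt_of_le (f := fun t => b c (φ (γ t)))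
      zero_le_one ?_ ?_ ?_
    · exact (b.toContinuousBilinearMap c).continuous.comp_continuousOn
        (h.contDiffOn.continuousOn.comp hγ.continuousOn hU)
    · intro t ht
      have ht' := Ioo_subset_Icc_self ht
      have h1 : HasDerivAt γ (derivWithin γ (Icc 0 1) t) t :=
        ((hγ.differentiableOn (by simp)) t ht').hasDerivWithinAt.hasDerivAt
          (Icc_mem_nhds ht.1 ht.2)
      exact (b.toContinuousBilinearMap c).hasFDerivAt.comp_hasDerivAt t
        ((h.hasFDerivAt (hU ht')).comp_hasDerivAt t h1)
    · exact (hcb.mono (by rw [uIcc_of_le zero_le_one])).intervalIntegrable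
  have hle : b c c ≤ √(b c c) * curveLength g γ := by
    refine hI.symm.le.trans ?_
    rw [hlen, ← intervalIntegral.integral_const_mul]
    refine intervalIntegral.integral_mono_on zero_le_one ?_ ?_ fun t _ =>
      (le_abs_self _).trans (h.abs_form_le _ _)
    · exact (hcb.mono (by rw [uIcc_of_le zero_le_one])).intervalIntegrable
    · exact ((hcs.mono (by rw [uIcc_of_le zero_le_one])).const_mul _).intervalIntegrable
  -- If the chord vanishes, `√(b c c)` cannot be cancelled, but then only nonnegativity of the
  -- length is claimed.
  rcases (Real.sqrt_nonneg (b c c)).eq_or_lt with h0 | h0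
  · rw [← h0, hlen]
    exact intervalIntegral.integral_nonneg zero_le_one fun t _ => Real.sqrt_nonneg _
  · refine le_of_mul_le_mul_left ?_ h0
    rwa [Real.mul_self_sqrt (h.form_nonneg c)]

/-- The lower bound is attained by the segment in the chart, whose speed is constant. -/
theorem rieDist_eq (h : FlatChart U g φ ψ b) {P Q : E} (hP : P ∈ U) (hQ : Q ∈ U) :
    rieDist U g P Q = √(b (φ Q - φ P) (φ Q - φ P)) := by
  refine IsLeast.csInf_eq ⟨?_, ?_⟩
  · have hg := h.isGeodesicOn_line (φ P) (φ Q - φ P)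
    have hs : ContDiffOn ℝ 1 (fun t : ℝ => ψ (φ P + t • (φ Q - φ P))) (Icc 0 1) :=
      (hg.smooth.of_le (by norm_cast)).mono (subset_univ _)
    refine ⟨_, hs, fun t _ => h.inv_mem _, by simp [h.left_inv P hP],
      by simp [h.left_inv Q hQ], ?_⟩
    rw [curveLength, intervalIntegral.integral_congr
      (g := fun _ => √(b (φ Q - φ P) (φ Q - φ P)))]
    · simp
    intro t ht
    rw [uIcc_of_le zero_le_one] at ht
    have h4 : HasDerivAt (fun t : ℝ => φ P + t • (φ Q - φ P)) (φ Q - φ P) t := by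
      simpa using ((hasDerivAt_id t).smul_const (φ Q - φ P)).const_add (φ P)
    have h5 := ((h.hasFDerivAt_inv _).comp_hasDerivAt t h4).hasDerivWithinAt (s := Icc 0 1)
    have h6 := h5.derivWithin (uniqueDiffOn_Icc zero_lt_one t ht)
    have h7 := h.fderiv_fderiv_inv (h.inv_mem (φ P + t • (φ Q - φ P))) (φ Q - φ P)
    rw [h.right_inv] at h7
    simp only [Function.comp_def] at h6
    simp only [h6, h.metric _ (h.inv_mem _), h7]
  · rintro l ⟨γ, hγ, hU, rfl, rfl, rfl⟩
    exact h.sqrt_form_le_curveLength hγ hU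

theorem mem_hyperplane_iff (h : FlatChart U g φ ψ b) {P : E} (hP : P ∈ U) (A Q : E) :
    Q ∈ hyperplane U g P A ↔ Q ∈ U ∧ b (φ Q - φ P) (fderiv ℝ φ P A) = 0 := by
  refine and_congr_right fun hQ => ?_
  rw [h.rieLog_eq hP hQ, h.metric P hP, h.fderiv_fderiv_inv hP]

/-- Euclidean distance from a point to a hyperplane: the orthogonal projection attains it and
Cauchy–Schwarz bounds it below. Multiplying by the norm of the normal also covers a zero normal. -/
theorem sqrt_mul_marginDist (h : FlatChart U g φ ψ b) {P S : E} (hP : P ∈ U) (hS : S ∈ U) (A : E) :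
    √(g P A A) * marginDist U g S (hyperplane U g P A) =
      |b (φ S - φ P) (fderiv ℝ φ P A)| := by
  set a := fderiv ℝ φ P A with ha
  rw [h.metric P hP, ← ha]
  by_cases h0 : a = 0
  · simp [h0]
  have hpos := h.posDef a h0
  have hsq : 0 < √(b a a) := Real.sqrt_pos.2 hpos
  have key : marginDist U g S (hyperplane U g P A) = |b (φ S - φ P) a| / √(b a a) := by
    refine IsLeast.csInf_eq ⟨?_, ?_⟩
    -- `φ S - c • a` is the foot of the perpendicular from `φ S`.
    · set c := b (φ S - φ P) a / b a a with hc
      have hR : ψ (φ S - c • a) ∈ U := h.inv_mem _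
      refine ⟨ψ (φ S - c • a), (h.mem_hyperplane_iff hP A _).2 ⟨hR, ?_⟩, ?_⟩
      · rw [h.right_inv, ← ha, sub_right_comm, map_sub, map_smul, LinearMap.sub_apply,
          LinearMap.smul_apply, smul_eq_mul, hc, div_mul_cancel₀ _ hpos.ne', sub_self]
      · simp only [h.rieDist_eq hS hR, h.right_inv]
        have : φ S - c • a - φ S = -(c • a) := by abel
        rw [this]
        simp only [map_neg, LinearMap.neg_apply, map_smul, LinearMap.smul_apply,
          smul_eq_mul]
        rw [mul_neg, neg_neg, ← mul_assoc, Real.sqrt_mul (mul_self_nonneg c), Real.sqrt_mul_self_eq_abs, hc, abs_div,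
          abs_of_pos hpos, div_mul_eq_mul_div, div_eq_div_iff hpos.ne' hsq.ne', mul_assoc,
          Real.mul_self_sqrt hpos.le]
    · rintro _ ⟨Q, hQ, rfl⟩
      obtain ⟨hQU, hQ0⟩ := (h.mem_hyperplane_iff hP A _).1 hQ
      simp only [h.rieDist_eq hS hQU]
      rw [div_le_iff₀ hsq]
      have h1 : b (φ S - φ P) a = - b (φ Q - φ S) a := by
        have : φ S - φ P = (φ Q - φ P) - (φ Q - φ S) := by abel
        rw [this, map_sub, LinearMap.sub_apply, hQ0, zero_sub]
      rw [h1, abs_neg]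
      exact h.abs_form_le _ _
  rw [key, mul_div_cancel₀ _ hsq.ne']

/-- The score is `sign x * |x| = x`. -/
theorem score_eq (h : FlatChart U g φ ψ b) {P S : E} (hP : P ∈ U) (hS : S ∈ U) (A : E) :
    score U g P A S = b (φ S - φ P) (fderiv ℝ φ P A) := by
  rw [score, mul_assoc, h.sqrt_mul_marginDist hP hS, h.rieLog_eq hP hS, h.metric P hP,
    h.fderiv_fderiv_inv hP, h.symm]
  set x := b (φ S - φ P) (fderiv ℝ φ P A)
  rcases lt_trichotomy x 0 with hx | hx | hx
  · rw [Real.sign_of_neg hx, abs_of_neg hx, neg_one_mul, neg_neg]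
  · rw [hx, abs_zero, mul_zero]
  · rw [Real.sign_of_pos hx, abs_of_pos hx, one_mul]

theorem score_transport (h : FlatChart U g φ ψ b) {O P S : E} (hO : O ∈ U) (hP : P ∈ U)
    (hS : S ∈ U) (A : E) :
    score U g P (transport U g O P A) S = b (φ S - φ P) (fderiv ℝ φ O A) := by
  rw [h.score_eq hP hS, h.transport_eq hO hP, h.fderiv_fderiv_inv hP]

theorem rieMLR_transport (h : FlatChart U g φ ψ b) {O S : E} (hO : O ∈ U) (hS : S ∈ U)
    {C : ℕ} {P : Fin C → E} (hP : ∀ k, P k ∈ U) (A : Fin C → E) :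
    rieMLR U g P (fun j => transport U g O (P j) (A j)) S =
      softmax fun j => b (φ S - φ (P j)) (fderiv ℝ φ O (A j)) := by
  rw [rieMLR]
  exact congrArg softmax (funext fun j => h.score_transport hO (hP j) hS (A j))

end FlatChart

end

end OpenRiem

/-! ### Inverse function theorem for a map with a global left inverse -/

section InverseFunction

open Topology

variable {E : Type*} [NormedAddCommGroup E] [NormedSpace ℝ E] [FiniteDimensional ℝ E]
variable {F : Type*} [NormedAddCommGroup F] [NormedSpace ℝ F] [FiniteDimensional ℝ F]

/-- A smooth map with injective differentials between spaces of equal dimension, with a left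
inverse, is a diffeomorphism onto its open range. -/
theorem ContDiff.isOpen_range_and_contDiffOn_of_leftInverse {ψ : F → E} {φ : E → F}
    (hψ : ContDiff ℝ ∞ ψ) (hdim : Module.finrank ℝ F = Module.finrank ℝ E)
    (hinj : ∀ x v, fderiv ℝ ψ x v = 0 → v = 0) (hφ : ∀ x, φ (ψ x) = x) :
    IsOpen (range ψ) ∧ ContDiffOn ℝ ∞ φ (range ψ) := by
  have hequiv : ∀ x, ∃ e : F ≃L[ℝ] E, HasFDerivAt ψ (e : F →L[ℝ] E) x := fun x => by
    have hi : Function.Injective (fderiv ℝ ψ x : F →ₗ[ℝ] E) :=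
      (injective_iff_map_eq_zero _).2 (hinj x)
    let e := (LinearEquiv.ofInjectiveOfFinrankEq _ hi hdim).toContinuousLinearEquiv
    refine ⟨e, ?_⟩
    have : (e : F →L[ℝ] E) = fderiv ℝ ψ x := by ext; rfl
    rw [this]
    exact (hψ.contDiffAt.differentiableAt (by simp)).hasFDerivAt
  constructor
  · rw [isOpen_iff_mem_nhds]
    rintro _ ⟨x, rfl⟩
    obtain ⟨e, he⟩ := hequiv x
    have hs := hψ.contDiffAt.hasStrictFDerivAt' he (by simp)
    rw [← hs.map_nhds_eq_of_equiv]
    exact Filter.range_mem_map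
  · rintro _ ⟨x, rfl⟩
    obtain ⟨e, he⟩ := hequiv x
    have hs := hψ.contDiffAt.hasStrictFDerivAt' he (by simp)
    -- The local inverse of `ψ` is smooth, and the left inverse `φ` agrees with it near `ψ x`.
    have h1 := (hψ.contDiffAt (x := x)).to_localInverse he (by simp)
    exact (h1.congr_of_eventuallyEq
      (hs.localInverse_unique (Filter.Eventually.of_forall hφ))).contDiffWithinAt

end InverseFunction

/-! ### Smoothness and derivatives through matrix entries -/

section FiniteDimensionalCalculus

variable {G : Type*} [NormedAddCommGroup G] [NormedSpace ℝ G]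

/-- Compose with a linear projection onto the subspace. -/
theorem contDiff_of_contDiff_coe {E : Type*} [NormedAddCommGroup E] [NormedSpace ℝ E]
    [FiniteDimensional ℝ E] {p : Submodule ℝ E} {f : G → p} {k : ℕ∞ω}
    (hf : ContDiff ℝ k fun x => (f x : E)) : ContDiff ℝ k f := by
  obtain ⟨r, hr⟩ := p.subtype.exists_leftInverse_of_injective p.ker_subtype
  have h1 := r.toContinuousLinearMap.contDiff.comp hf
  have h2 : r.toContinuousLinearMap ∘ (fun x => (f x : E)) = f :=
    funext fun x => LinearMap.congr_fun hr (f x)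
  rwa [h2] at h1

/-- The entries of a matrix, as continuous linear forms. -/
noncomputable def Matrix.entryCLM {n : ℕ} (i j : Fin n) : Matrix (Fin n) (Fin n) ℝ →L[ℝ] ℝ :=
  (Matrix.entryLinearMap ℝ ℝ i j).toContinuousLinearMap

theorem contDiff_matrix {n : ℕ} {f : G → Matrix (Fin n) (Fin n) ℝ} {k : ℕ∞ω}
    (hf : ∀ i j, ContDiff ℝ k fun x => f x i j) : ContDiff ℝ k f := by
  have h : f = fun x => ∑ i, ∑ j, f x i j • Matrix.single i j (1 : ℝ) := funext fun x => by
    simpa using Matrix.matrix_eq_sum_single (f x)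
  rw [h]
  exact ContDiff.sum fun i _ => ContDiff.sum fun j _ => (hf i j).smul contDiff_const

theorem HasFDerivAt.apply_eq_of_sum_mul {ι : Type*} [Fintype ι] {f g : ι → G → ℝ} {x : G}
    {f' g' : ι → G →L[ℝ] ℝ} {T : G →L[ℝ] ℝ} (h : HasFDerivAt (fun y => ∑ k, f k y * g k y) T x)
    (hf : ∀ k, HasFDerivAt (f k) (f' k) x) (hg : ∀ k, HasFDerivAt (g k) (g' k) x) (v : G) :
    T v = ∑ k, (f k x * g' k v + g k x * f' k v) := by
  rw [h.unique (HasFDerivAt.fun_sum (u := Finset.univ) fun k _ => (hf k).mul (hg k))]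
  simp

end FiniteDimensionalCalculus

variable {n : ℕ}

/-! ### The exponential of symmetric matrices -/

theorem SymMat.isSelfAdjoint (S : SymMat n) : IsSelfAdjoint (S : Matrix (Fin n) (Fin n) ℝ) := S.2

theorem SymMat.isHermitian (S : SymMat n) : (S : Matrix (Fin n) (Fin n) ℝ).IsHermitian := S.2

theorem spectrum_pos_of_mem_SPD {S : SymMat n} (hS : S ∈ SPD n) :
    ∀ x ∈ spectrum ℝ (S : Matrix (Fin n) (Fin n) ℝ), 0 < x := by
  intro x hx
  have h : (S : Matrix (Fin n) (Fin n) ℝ).PosDef := hS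
  rw [h.1.spectrum_real_eq_range_eigenvalues] at hx
  obtain ⟨i, rfl⟩ := hx
  exact h.eigenvalues_pos i

theorem continuousOn_log_spectrum {S : SymMat n} (hS : S ∈ SPD n) :
    ContinuousOn Real.log (spectrum ℝ (S : Matrix (Fin n) (Fin n) ℝ)) :=
  Real.continuousOn_log.mono fun x hx => (spectrum_pos_of_mem_SPD hS x hx).ne'

/-- The matrix exponential on symmetric matrices. -/
noncomputable def symExp (X : SymMat n) : SymMat n := symFun Real.exp X

theorem symExp_mlog {S : SymMat n} (hS : S ∈ SPD n) : symExp (mlog S) = S := by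
  apply Subtype.ext
  show cfc Real.exp (cfc Real.log (S : Matrix (Fin n) (Fin n) ℝ)) = _
  rw [← cfc_comp' Real.exp Real.log _ Real.continuous_exp.continuousOn
      (continuousOn_log_spectrum hS) (SymMat.isSelfAdjoint S),
    cfc_congr (fun x hx => Real.exp_log (spectrum_pos_of_mem_SPD hS x hx)),
    cfc_id' ℝ _ (SymMat.isSelfAdjoint S)]

theorem mlog_symExp (X : SymMat n) : mlog (symExp X) = X := by
  apply Subtype.ext
  show cfc Real.log (cfc Real.exp (X : Matrix (Fin n) (Fin n) ℝ)) = _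
  rw [← cfc_comp' Real.log Real.exp _ (Real.continuousOn_log.mono ?_)
    Real.continuous_exp.continuousOn (SymMat.isSelfAdjoint X)]
  · rw [cfc_congr (fun x hx => Real.log_exp x), cfc_id' ℝ _ (SymMat.isSelfAdjoint X)]
  · rintro _ ⟨x, _, rfl⟩
    exact (Real.exp_pos x).ne'

theorem symExp_mem_SPD (X : SymMat n) : symExp X ∈ SPD n := by
  have h1 : (symExp X : Matrix (Fin n) (Fin n) ℝ).IsHermitian := SymMat.isHermitian _
  refine h1.posDef_iff_eigenvalues_pos.2 fun i => ?_
  have h2 := h1.eigenvalues_mem_spectrum_real i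
  have hc : spectrum ℝ (symExp X : Matrix (Fin n) (Fin n) ℝ) =
      Real.exp '' spectrum ℝ (X : Matrix (Fin n) (Fin n) ℝ) :=
    cfc_map_spectrum Real.exp _ (SymMat.isSelfAdjoint X) Real.continuous_exp.continuousOn
  rw [hc] at h2
  obtain ⟨x, _, hx⟩ := h2
  rw [← hx]
  exact Real.exp_pos x

theorem range_symExp : range (symExp (n := n)) = SPD n :=
  Subset.antisymm (range_subset_iff.2 symExp_mem_SPD) fun _ hS => ⟨_, symExp_mlog hS⟩

theorem mpow_eq_symExp (θ : ℝ) {S : SymMat n} (hS : S ∈ SPD n) :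
    mpow θ S = symExp (θ • mlog S) := by
  apply Subtype.ext
  have hc := continuousOn_log_spectrum hS
  show cfc (fun x => x ^ θ) (S : Matrix (Fin n) (Fin n) ℝ) =
    cfc Real.exp (θ • cfc Real.log (S : Matrix (Fin n) (Fin n) ℝ))
  rw [← cfc_const_mul θ _ _ hc, ← cfc_comp' Real.exp (fun x => θ * Real.log x) _
    Real.continuous_exp.continuousOn (hc.const_smul θ) (SymMat.isSelfAdjoint S)]
  exact cfc_congr fun x hx => by
    simp [Real.rpow_def_of_pos (spectrum_pos_of_mem_SPD hS x hx), mul_comm]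

section NormedExp

attribute [local instance] Matrix.frobeniusNormedRing Matrix.frobeniusNormedAlgebra

open NormedSpace

/-- Links the functional calculus, which gives the inverse `log`, to the power series, which gives
smoothness. -/
theorem coe_symExp (X : SymMat n) :
    (symExp X : Matrix (Fin n) (Fin n) ℝ) = exp (X : Matrix (Fin n) (Fin n) ℝ) :=
  @CFC.real_exp_eq_normedSpace_exp (Matrix (Fin n) (Fin n) ℝ) Matrix.frobeniusNormedRing _
    Matrix.frobeniusNormedAlgebra Matrix.IsHermitian.instContinuousFunctionalCalculus
    (X : Matrix (Fin n) (Fin n) ℝ) (SymMat.isSelfAdjoint X)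

theorem contDiff_symExp : ContDiff ℝ ∞ (symExp (n := n)) := by
  have h : ContDiff ℝ ∞ (exp : Matrix (Fin n) (Fin n) ℝ → _) :=
    contDiff_iff_contDiffAt.2 fun x => (exp_analytic x).contDiffAt
  refine contDiff_of_contDiff_coe ?_
  simp only [coe_symExp]
  exact h.comp (SymMat n).subtypeL.contDiff

theorem hasFDerivAt_symExp (X : SymMat n) : HasFDerivAt symExp (fderiv ℝ symExp X) X :=
  (contDiff_symExp.contDiffAt.differentiableAt (by simp)).hasFDerivAt

theorem hasFDerivAt_coe_symExp (X : SymMat n) :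
    HasFDerivAt (fun Y : SymMat n => (symExp Y : Matrix (Fin n) (Fin n) ℝ))
      ((SymMat n).subtypeL.comp (fderiv ℝ symExp X)) X :=
  (SymMat n).subtypeL.hasFDerivAt.comp X (hasFDerivAt_symExp X)

theorem symExp_zero : symExp (0 : SymMat n) = symOne n := by
  apply Subtype.ext
  rw [coe_symExp]
  exact exp_zero

theorem fderiv_symExp_zero : fderiv ℝ (symExp (n := n)) 0 = ContinuousLinearMap.id ℝ _ := by
  have h1 : HasFDerivAt (exp : Matrix (Fin n) (Fin n) ℝ → _) (1 : _ →L[ℝ] _)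
      ((SymMat n).subtypeL 0) := by
    rw [map_zero]; exact hasFDerivAt_exp_zero
  have h2 := h1.comp (0 : SymMat n) (SymMat n).subtypeL.hasFDerivAt
  have h3 := hasFDerivAt_coe_symExp (0 : SymMat n)
  simp only [coe_symExp] at h3
  ext1 V
  exact Subtype.ext (congrArg (fun T : SymMat n →L[ℝ] _ => T V) (h3.unique h2))

theorem coe_symExp_eq_mul_self (X : SymMat n) :
    (symExp X : Matrix (Fin n) (Fin n) ℝ) =
      symExp ((1 / 2 : ℝ) • X) * symExp ((1 / 2 : ℝ) • X) := by
  let _ : NormedAlgebra ℚ (Matrix (Fin n) (Fin n) ℝ) := NormedAlgebra.restrictScalars ℚ ℝ _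
  simp only [coe_symExp]
  refine Eq.trans ?_ (exp_add_of_commute (Commute.refl
    (((1 / 2 : ℝ) • X : SymMat n) : Matrix (Fin n) (Fin n) ℝ)))
  rw [Submodule.coe_smul, ← add_smul, add_halves, one_smul]
  rfl

/-- Differentiate `exp X = exp (X / 2) * exp (X / 2)`. -/
theorem fderiv_symExp_eq (X V : SymMat n) :
    (fderiv ℝ symExp X V : Matrix (Fin n) (Fin n) ℝ) =
      (1 / 2 : ℝ) • ((symExp ((1 / 2 : ℝ) • X) : Matrix (Fin n) (Fin n) ℝ) *
          (fderiv ℝ symExp ((1 / 2 : ℝ) • X) V : Matrix (Fin n) (Fin n) ℝ) +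
        (fderiv ℝ symExp ((1 / 2 : ℝ) • X) V : Matrix (Fin n) (Fin n) ℝ) *
          (symExp ((1 / 2 : ℝ) • X) : Matrix (Fin n) (Fin n) ℝ)) := by
  have h1 := (hasFDerivAt_coe_symExp ((1 / 2 : ℝ) • X)).comp X
    ((hasFDerivAt_id X).const_smul (1 / 2 : ℝ))
  have h2 := h1.mul' h1
  have h3 := hasFDerivAt_coe_symExp X
  simp only [Function.comp_def] at h2
  have h4 := h3.unique (h2.congr_of_eventuallyEq
    (Filter.Eventually.of_forall coe_symExp_eq_mul_self))
  have h5 := congrArg (fun T : SymMat n →L[ℝ] _ => T V) h4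
  refine h5.trans ?_
  change (symExp ((1 / 2 : ℝ) • X) : Matrix (Fin n) (Fin n) ℝ) *
      (fderiv ℝ symExp ((1 / 2 : ℝ) • X) ((1 / 2 : ℝ) • V) : Matrix (Fin n) (Fin n) ℝ) +
    (fderiv ℝ symExp ((1 / 2 : ℝ) • X) ((1 / 2 : ℝ) • V) : Matrix (Fin n) (Fin n) ℝ) *
      (symExp ((1 / 2 : ℝ) • X) : Matrix (Fin n) (Fin n) ℝ) = _
  rw [map_smul, Submodule.coe_smul, Matrix.mul_smul, Matrix.smul_mul, smul_add]

end NormedExp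

/-- Multiplying by `B` and taking traces gives `tr (B A B) = 0`. As `B A B` is positive semidefinite
it vanishes, and a nonzero column `v` of `B` would contradict `vᵀ A v > 0`. -/
theorem Matrix.PosDef.eq_zero_of_mul_add_mul_eq_zero {A B : Matrix (Fin n) (Fin n) ℝ}
    (hA : A.PosDef) (hB : B.IsSymm) (h : A * B + B * A = 0) : B = 0 := by
  have hBH : Bᴴ = B := by rw [Matrix.conjTranspose_eq_transpose_of_trivial, hB.eq]
  have hps : (Bᴴ * A * B).PosSemidef := hA.posSemidef.conjTranspose_mul_mul_same B
  have h1 : (Bᴴ * A * B).trace = 0 := by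
    have h2 := congrArg (fun M => (B * M).trace) h
    simp only [mul_add, Matrix.trace_add, mul_zero, Matrix.trace_zero] at h2
    rw [hBH]
    rw [← Matrix.mul_assoc, Matrix.trace_mul_comm B (B * A)] at h2
    linarith
  have h2 := hps.trace_eq_zero_iff.1 h1
  ext i j
  by_contra hne
  have hv : B *ᵥ Pi.single j 1 ≠ 0 := fun h0 => hne (by simpa using congrFun h0 i)
  have h3 := hA.dotProduct_mulVec_pos hv
  rw [Matrix.star_mulVec, ← Matrix.dotProduct_mulVec, Matrix.mulVec_mulVec, Matrix.mulVec_mulVec, h2] at h3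
  simp at h3

theorem fderiv_symExp_injective_of_half {X : SymMat n}
    (h : ∀ V, fderiv ℝ symExp ((1 / 2 : ℝ) • X) V = 0 → V = 0) (V : SymMat n)
    (hV : fderiv ℝ symExp X V = 0) : V = 0 := by
  refine h V (Subtype.ext ?_)
  have h1 := fderiv_symExp_eq X V
  rw [hV, Submodule.coe_zero, eq_comm, smul_eq_zero_iff_right (by norm_num)] at h1
  exact Matrix.PosDef.eq_zero_of_mul_add_mul_eq_zero (symExp_mem_SPD ((1 / 2 : ℝ) • X))
    (fderiv ℝ symExp ((1 / 2 : ℝ) • X) V).2 h1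

/-- The differential is the identity at `0`, hence invertible near `0`. Injectivity at `X / 2`
implies injectivity at `X`, so repeated doubling from `X / 2 ^ k`, close to `0`, reaches `X`. -/
theorem fderiv_symExp_injective (X V : SymMat n) (hV : fderiv ℝ symExp X V = 0) : V = 0 := by
  have hc : Continuous (fderiv ℝ (symExp (n := n))) := contDiff_symExp.continuous_fderiv (by simp)
  have h0 : ∀ᶠ Y in nhds (0 : SymMat n), ∀ V, fderiv ℝ symExp Y V = 0 → V = 0 := by
    have h1 : range ((↑) : (SymMat n ≃L[ℝ] SymMat n) → SymMat n →L[ℝ] SymMat n) ∈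
        nhds (fderiv ℝ symExp (0 : SymMat n)) := by
      rw [fderiv_symExp_zero]
      exact (ContinuousLinearEquiv.refl ℝ (SymMat n)).nhds
    filter_upwards [hc.continuousAt.preimage_mem_nhds h1] with Y hY V hV
    obtain ⟨e, he⟩ := hY
    rw [← he] at hV
    exact e.map_eq_zero_iff.1 hV
  have ht : Filter.Tendsto (fun k : ℕ => ((1 / 2 : ℝ) ^ k) • X) Filter.atTop (nhds 0) := by
    simpa using (tendsto_pow_atTop_nhds_zero_of_lt_one (by norm_num : (0 : ℝ) ≤ 1 / 2)
      (by norm_num)).smul_const X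
  obtain ⟨k, hk⟩ := (ht.eventually h0).exists
  induction k with
  | zero => exact hk V (by simpa using hV)
  | succ k ih =>
    refine ih (fderiv_symExp_injective_of_half ?_)
    rwa [smul_smul, ← pow_succ']

theorem isOpen_SPD : IsOpen (SPD n) :=
  range_symExp (n := n) ▸ (contDiff_symExp.isOpen_range_and_contDiffOn_of_leftInverse rfl
    fderiv_symExp_injective mlog_symExp).1

theorem contDiffOn_mlog : ContDiffOn ℝ ∞ mlog (SPD n) :=
  range_symExp (n := n) ▸ (contDiff_symExp.isOpen_range_and_contDiffOn_of_leftInverse rfl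
    fderiv_symExp_injective mlog_symExp).2

theorem symOne_mem_SPD : symOne n ∈ SPD n := symExp_zero (n := n) ▸ symExp_mem_SPD 0

theorem mlog_symOne : mlog (symOne n) = 0 := by
  rw [← symExp_zero, mlog_symExp]

/-! ### The Log-Euclidean metric -/

theorem innerAB_apply (α β : ℝ) (V W : SymMat n) :
    innerAB n α β V W = α * frob (V : Matrix (Fin n) (Fin n) ℝ) W
      + β * (Matrix.trace (V : Matrix (Fin n) (Fin n) ℝ)
        * Matrix.trace (W : Matrix (Fin n) (Fin n) ℝ)) := rfl

theorem frob_comm (V W : Matrix (Fin n) (Fin n) ℝ) : frob V W = frob W V := by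
  simp only [frob, mul_comm]

theorem frob_self_pos {V : Matrix (Fin n) (Fin n) ℝ} (hV : V ≠ 0) : 0 < frob V V := by
  obtain ⟨i, j, hij⟩ : ∃ i j, V i j ≠ 0 := by
    by_contra! h
    exact hV (Matrix.ext h)
  refine Finset.sum_pos' (fun i _ => Finset.sum_nonneg fun j _ => mul_self_nonneg _)
    ⟨i, Finset.mem_univ i, Finset.sum_pos' (fun j _ => mul_self_nonneg _)
      ⟨j, Finset.mem_univ j, mul_self_pos.2 hij⟩⟩

theorem trace_sq_le_frob (V : Matrix (Fin n) (Fin n) ℝ) : V.trace ^ 2 ≤ n * frob V V := by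
  have h1 : V.trace ^ 2 ≤ n * ∑ i, V i i ^ 2 := by
    simpa [Matrix.trace] using sq_sum_le_card_mul_sum_sq (s := Finset.univ) (f := fun i => V i i)
  refine h1.trans (mul_le_mul_of_nonneg_left ?_ n.cast_nonneg)
  refine Finset.sum_le_sum fun i _ => ?_
  rw [sq]
  exact Finset.single_le_sum (f := fun j => V i j * V i j) (fun j _ => mul_self_nonneg _)
    (Finset.mem_univ i)

theorem innerAB_self_pos {α β : ℝ} (hαβ : 0 < min α (α + n * β)) {V : SymMat n} (hV : V ≠ 0) :
    0 < innerAB n α β V V := by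
  obtain ⟨hα, hβ⟩ := lt_min_iff.1 hαβ
  have hV' : (V : Matrix (Fin n) (Fin n) ℝ) ≠ 0 := fun h => hV (Subtype.ext h)
  have hf := frob_self_pos hV'
  rw [innerAB_apply, ← sq]
  rcases le_or_gt 0 β with h | h
  · exact add_pos_of_pos_of_nonneg (mul_pos hα hf) (mul_nonneg h (sq_nonneg _))
  -- For `β < 0`, the bound `tr(V)² ≤ n ⟨V, V⟩` makes the form at least `(α + n β) ⟨V, V⟩`.
  · have h1 := mul_le_mul_of_nonpos_left (trace_sq_le_frob (V : Matrix (Fin n) (Fin n) ℝ)) h.le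
    have h2 := mul_pos hβ hf
    linarith

theorem flatChart_lemMetric {α β : ℝ} (hαβ : 0 < min α (α + n * β)) :
    OpenRiem.FlatChart (SPD n) (lemMetric n α β) mlog symExp (innerAB n α β) where
  isOpen := isOpen_SPD
  contDiffOn := contDiffOn_mlog
  contDiff_inv := contDiff_symExp
  inv_mem := symExp_mem_SPD
  left_inv _ hP := symExp_mlog hP
  right_inv := mlog_symExp
  symm V W := by rw [innerAB_apply, innerAB_apply, frob_comm, mul_comm (Matrix.trace _)]
  posDef _ hV := innerAB_self_pos hαβ hV
  metric _ _ _ _ := rfl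

theorem hasFDerivAt_mlog_symOne :
    HasFDerivAt mlog (ContinuousLinearMap.id ℝ (SymMat n)) (symOne n) := by
  have h : HasFDerivAt symExp
      (ContinuousLinearEquiv.refl ℝ (SymMat n) : SymMat n →L[ℝ] SymMat n) 0 := by
    have := hasFDerivAt_symExp (0 : SymMat n)
    rwa [fderiv_symExp_zero] at this
  have h2 := contDiff_symExp.contDiffAt.hasStrictFDerivAt' h (by simp)
  have h3 := h2.to_local_left_inverse (Filter.Eventually.of_forall mlog_symExp)
  rw [symExp_zero] at h3
  exact h3.hasFDerivAt

theorem fderiv_mlog_symOne (A : SymMat n) : fderiv ℝ mlog (symOne n) A = A :=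
  congrArg (fun T : SymMat n →L[ℝ] SymMat n => T A) hasFDerivAt_mlog_symOne.fderiv

theorem form_chart_lemMetric (α β : ℝ) (S P A : SymMat n) :
    innerAB n α β (mlog S - mlog P) (fderiv ℝ mlog (symOne n) A) =
      innerAB n α β (mlog S - mlog P) A := by
  rw [fderiv_mlog_symOne]

/-! ### The Cholesky decomposition -/

section LowerTriangular

variable {L M : Matrix (Fin n) (Fin n) ℝ}

theorem Matrix.isLowerTriangular_iff : L.IsLowerTriangular ↔ ∀ i j, i < j → L i j = 0 :=
  ⟨fun h _ _ hij => h hij, fun h _ _ hij => h _ _ hij⟩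

theorem Matrix.IsLowerTriangular.mul_apply_self (hL : L.IsLowerTriangular)
    (hM : M.IsLowerTriangular) (i : Fin n) : (L * M) i i = L i i * M i i := by
  rw [Matrix.mul_apply]
  refine Finset.sum_eq_single i (fun j _ hj => ?_) (fun h => absurd (Finset.mem_univ i) h)
  rcases lt_or_gt_of_ne hj with h | h
  · rw [Matrix.isLowerTriangular_iff.1 hM j i h, mul_zero]
  · rw [Matrix.isLowerTriangular_iff.1 hL i j h, zero_mul]

theorem Matrix.IsLowerTriangular.isUnit_det (hL : L.IsLowerTriangular) (hd : ∀ i, L i i ≠ 0) :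
    IsUnit L.det := by
  rw [Matrix.det_of_isLowerTriangular L hL]
  exact (Finset.prod_ne_zero_iff.2 fun i _ => hd i).isUnit

theorem Matrix.IsLowerTriangular.inv (hL : L.IsLowerTriangular) (hd : IsUnit L.det) :
    L⁻¹.IsLowerTriangular := by
  let _ := L.invertibleOfIsUnitDet hd
  exact Matrix.blockTriangular_inv_of_blockTriangular hL

/-- The Cholesky factor is unique. -/
theorem Matrix.IsLowerTriangular.eq_of_mul_transpose_eq (hL : L.IsLowerTriangular)
    (hM : M.IsLowerTriangular) (hLd : ∀ i, 0 < L i i) (hMd : ∀ i, 0 < M i i)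
    (h : L * Lᵀ = M * Mᵀ) : L = M := by
  have hMu := hM.isUnit_det fun i => (hMd i).ne'
  -- `C` is lower triangular and orthogonal, so `Cᵀ = C⁻¹` is lower triangular too. Thus `C` is
  -- diagonal with positive entries of square `1`, that is, `C = 1`.
  set C := M⁻¹ * L with hCdef
  have hC : C.IsLowerTriangular := (hM.inv hMu).mul hL
  have hMC : M * C = L := by rw [hCdef, ← Matrix.mul_assoc, Matrix.mul_nonsing_inv _ hMu,
    Matrix.one_mul]
  have hCC : C * Cᵀ = 1 := by
    rw [hCdef, Matrix.transpose_mul, Matrix.mul_assoc, ← Matrix.mul_assoc L, h,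
      Matrix.mul_assoc M, ← Matrix.mul_assoc, Matrix.nonsing_inv_mul _ hMu, Matrix.one_mul,
      ← Matrix.transpose_mul, Matrix.nonsing_inv_mul _ hMu, Matrix.transpose_one]
  have hCd : ∀ i, 0 < C i i := fun i => by
    have h1 := hM.mul_apply_self hC i
    rw [hMC] at h1
    exact pos_of_mul_pos_right (h1 ▸ hLd i) (hMd i).le
  have hCT : Cᵀ.IsLowerTriangular := by
    rw [← Matrix.inv_eq_right_inv hCC]
    exact hC.inv (hC.isUnit_det fun i => (hCd i).ne')
  have hC1 : C = 1 := by
    ext i j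
    rcases lt_trichotomy i j with hij | rfl | hij
    · rw [Matrix.isLowerTriangular_iff.1 hC i j hij, Matrix.one_apply_ne hij.ne]
    · have h1 := hC.mul_apply_self hCT i
      rw [hCC, Matrix.one_apply_eq, Matrix.transpose_apply] at h1
      rw [Matrix.one_apply_eq]
      nlinarith [hCd i]
    · rw [← Matrix.transpose_apply C, Matrix.isLowerTriangular_iff.1 hCT j i hij,
        Matrix.one_apply_ne hij.ne']
  rw [← hMC, hC1, Matrix.mul_one]

/-- The Cholesky factor exists. -/
theorem Matrix.PosDef.exists_cholesky {S : Matrix (Fin n) (Fin n) ℝ} (hS : S.PosDef) :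
    ∃ L : Matrix (Fin n) (Fin n) ℝ, L.IsLowerTriangular ∧ (∀ i, 0 < L i i) ∧ L * Lᵀ = S := by
  have hI : (LDL.lowerInv hS).IsLowerTriangular :=
    Matrix.isLowerTriangular_iff.2 fun i j hij => LDL.lowerInv_triangular hS hij
  have hIu : IsUnit (LDL.lowerInv hS).det := Matrix.isUnit_det_of_invertible _
  have hA : (LDL.lower hS).IsLowerTriangular := hI.inv hIu
  have hAu : IsUnit (LDL.lower hS).det := Matrix.isUnit_nonsing_inv_det _ hIu
  have hAd : ∀ i, LDL.lower hS i i ≠ 0 := by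
    rw [Matrix.det_of_isLowerTriangular _ hA] at hAu
    exact fun i => Finset.prod_ne_zero_iff.1 hAu.ne_zero i (Finset.mem_univ i)
  have hD : ∀ i, 0 < LDL.diagEntries hS i := fun i => by
    have h1 : (LDL.diag hS).PosDef := by
      rw [LDL.diag_eq_lowerInv_conj]
      exact hS.mul_mul_conjTranspose_same
        (Matrix.vecMul_injective_of_isUnit ((Matrix.isUnit_iff_isUnit_det _).2 hIu))
    simpa [LDL.diag] using h1.diag_pos (i := i)
  set A := LDL.lower hS
  set d := LDL.diagEntries hS with hd
  -- A square root of `d` whose signs make the diagonal of `A * diagonal s` positive; the diagonal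
  -- of `A` is only known to be nonzero here.
  set s : Fin n → ℝ := fun i => √(d i) * (A i i / |A i i|) with hs
  have hss : ∀ i, s i * s i = d i := fun i => by
    rw [hs]
    have h1 := Real.mul_self_sqrt (hD i).le
    have h2 : A i i / |A i i| * (A i i / |A i i|) = 1 := by
      rw [div_mul_div_comm, abs_mul_abs_self, div_self (mul_self_ne_zero.2 (hAd i))]
    calc _ = (√(d i) * √(d i)) * (A i i / |A i i| * (A i i / |A i i|)) := by ring
      _ = _ := by rw [h1, h2, mul_one]
  refine ⟨A * Matrix.diagonal s, ?_, fun i => ?_, ?_⟩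
  · rw [Matrix.isLowerTriangular_iff]
    intro i j hij
    rw [Matrix.mul_diagonal, Matrix.isLowerTriangular_iff.1 hA i j hij, zero_mul]
  · rw [Matrix.mul_diagonal, hs]
    have h2 : A i i * (√(d i) * (A i i / |A i i|)) = √(d i) * |A i i| := by
      have h3 : |A i i| ≠ 0 := abs_ne_zero.2 (hAd i)
      field_simp
      rw [sq_abs, mul_comm]
    rw [h2]
    exact mul_pos (Real.sqrt_pos.2 (hD i)) (abs_pos.2 (hAd i))
  · have h1 : A * LDL.diag hS * Aᴴ = S := LDL.lower_conj_diag hS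
    rw [Matrix.transpose_mul, Matrix.diagonal_transpose, Matrix.mul_assoc,
      ← Matrix.mul_assoc (Matrix.diagonal s), Matrix.diagonal_mul_diagonal]
    simp only [hss]
    rw [← Matrix.mul_assoc, ← h1, Matrix.conjTranspose_eq_transpose_of_trivial]
    rfl

end LowerTriangular

/-- The space of lower triangular matrices. -/
def LowTri (n : ℕ) : Submodule ℝ (Matrix (Fin n) (Fin n) ℝ) where
  carrier := {M | ∀ i j, i < j → M i j = 0}
  add_mem' hA hB i j hij := by rw [Matrix.add_apply, hA i j hij, hB i j hij, add_zero]
  zero_mem' _ _ _ := rfl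
  smul_mem' c A hA i j hij := by rw [Matrix.smul_apply, hA i j hij, smul_zero]

theorem LowTri.apply_eq_zero (M : LowTri n) {i j : Fin n} (hij : i < j) :
    (M : Matrix (Fin n) (Fin n) ℝ) i j = 0 := M.2 i j hij

theorem lcmY_mem_lowTri (A : SymMat n) : lcmY A ∈ LowTri n := fun i j hij => by
  simp [lcmY, strictLower, diagPart, hij.not_gt, hij.ne]

theorem lcmY_apply (A : SymMat n) (i j : Fin n) : lcmY A i j =
    if j < i then (A : Matrix (Fin n) (Fin n) ℝ) i j else
      if i = j then (A : Matrix (Fin n) (Fin n) ℝ) i j / 2 else 0 := by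
  rcases lt_trichotomy i j with h | rfl | h
  · simp [lcmY, strictLower, diagPart, h.not_gt, h.ne]
  · simp [lcmY, strictLower, diagPart, div_eq_inv_mul]
  · simp [lcmY, strictLower, diagPart, h, h.ne']

/-- A symmetric matrix is the sum `M + Mᵀ` for exactly one lower triangular matrix `M`. -/
noncomputable def lowTriEquivSymMat (n : ℕ) : LowTri n ≃ₗ[ℝ] SymMat n where
  toFun M := ⟨(M : Matrix (Fin n) (Fin n) ℝ) + (M : Matrix (Fin n) (Fin n) ℝ)ᵀ,
    Matrix.isSymm_add_transpose_self _⟩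
  map_add' M N := Subtype.ext (by
    simp only [Submodule.coe_add, Matrix.transpose_add]; abel)
  map_smul' c M := Subtype.ext (by simp)
  invFun A := ⟨lcmY A, lcmY_mem_lowTri A⟩
  left_inv M := by
    apply Subtype.ext
    ext i j
    simp only [lcmY_apply, Matrix.add_apply, Matrix.transpose_apply]
    rcases lt_trichotomy i j with h | rfl | h
    · simp [h.not_gt, h.ne, LowTri.apply_eq_zero M h]
    · simp
    · simp [h, LowTri.apply_eq_zero M h]
  right_inv A := by
    apply Subtype.ext
    ext i j
    have hA := A.2.apply i j
    simp only [lcmY_apply, Matrix.add_apply, Matrix.transpose_apply]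
    rcases lt_trichotomy i j with h | rfl | h
    · simp [h.not_gt, h.ne, h, hA]
    · simp
    · simp [h, h.not_gt, h.ne]

/-- The lower triangular matrix with logarithmic coordinates `M`: the diagonal entries are
exponentiated. -/
noncomputable def expDiag (M : LowTri n) : Matrix (Fin n) (Fin n) ℝ :=
  Matrix.of fun i j => if i = j then Real.exp ((M : Matrix (Fin n) (Fin n) ℝ) i j)
    else (M : Matrix (Fin n) (Fin n) ℝ) i j

theorem expDiag_apply_self (M : LowTri n) (i : Fin n) :
    expDiag M i i = Real.exp ((M : Matrix (Fin n) (Fin n) ℝ) i i) := by simp [expDiag]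

theorem expDiag_apply_ne (M : LowTri n) {i j : Fin n} (h : i ≠ j) :
    expDiag M i j = (M : Matrix (Fin n) (Fin n) ℝ) i j := by simp [expDiag, h]

theorem expDiag_pos (M : LowTri n) (i : Fin n) : 0 < expDiag M i i := by
  rw [expDiag_apply_self]; exact Real.exp_pos _

theorem expDiag_isLowerTriangular (M : LowTri n) : (expDiag M).IsLowerTriangular :=
  Matrix.isLowerTriangular_iff.2 fun i j hij => by
    rw [expDiag_apply_ne M hij.ne, LowTri.apply_eq_zero M hij]

theorem expDiag_isUnit_det (M : LowTri n) : IsUnit (expDiag M).det :=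
  (expDiag_isLowerTriangular M).isUnit_det fun i => (expDiag_pos M i).ne'

theorem expDiag_zero : expDiag (0 : LowTri n) = 1 := by
  ext i j
  rcases eq_or_ne i j with rfl | h
  · simp [expDiag_apply_self]
  · simp [expDiag_apply_ne _ h, Matrix.one_apply_ne h]

/-- The logarithmic coordinates `⌊L⌋ + dlog L` of a matrix. -/
noncomputable def logDiag (L : Matrix (Fin n) (Fin n) ℝ) : LowTri n :=
  ⟨strictLower L + dlog L, fun i j hij => by simp [strictLower, dlog, hij.not_gt, hij.ne]⟩

theorem logDiag_expDiag (M : LowTri n) : logDiag (expDiag M) = M := by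
  apply Subtype.ext
  ext i j
  rcases lt_trichotomy i j with h | rfl | h
  · rw [LowTri.apply_eq_zero _ h, LowTri.apply_eq_zero M h]
  · simp [logDiag, strictLower, dlog, expDiag_apply_self]
  · simp [logDiag, strictLower, dlog, h, h.ne', expDiag_apply_ne _ h.ne']

theorem expDiag_logDiag {L : Matrix (Fin n) (Fin n) ℝ} (hL : L.IsLowerTriangular)
    (hd : ∀ i, 0 < L i i) : expDiag (logDiag L) = L := by
  ext i j
  rcases lt_trichotomy i j with h | rfl | h
  · rw [expDiag_apply_ne _ h.ne, LowTri.apply_eq_zero _ h, Matrix.isLowerTriangular_iff.1 hL i j h]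
  · rw [expDiag_apply_self]
    simp [logDiag, strictLower, dlog, Real.exp_log (hd i)]
  · rw [expDiag_apply_ne _ h.ne']
    simp [logDiag, strictLower, dlog, h, h.ne']

/-- The inverse of the Log-Cholesky chart. -/
noncomputable def cholInv (M : LowTri n) : SymMat n :=
  ⟨expDiag M * (expDiag M)ᵀ, Matrix.isSymm_mul_transpose_self _⟩

/-- The Log-Cholesky chart. -/
noncomputable def cholLog (P : SymMat n) : LowTri n := logDiag (chol P)

/-- The factor chosen by `chol` satisfies its specification, since `expDiag M` does, and uniqueness
identifies the two. -/
theorem chol_cholInv (M : LowTri n) : chol (cholInv M) = expDiag M := by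
  have h : (∀ i j, i < j → chol (cholInv M) i j = 0) ∧ (∀ i, 0 < chol (cholInv M) i i) ∧
      chol (cholInv M) * (chol (cholInv M))ᵀ = (cholInv M : Matrix (Fin n) (Fin n) ℝ) :=
    Classical.epsilon_spec (p := fun L : Matrix (Fin n) (Fin n) ℝ =>
      (∀ i j, i < j → L i j = 0) ∧ (∀ i, 0 < L i i) ∧
        L * Lᵀ = (cholInv M : Matrix (Fin n) (Fin n) ℝ))
      ⟨expDiag M, Matrix.isLowerTriangular_iff.1 (expDiag_isLowerTriangular M), expDiag_pos M, rfl⟩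
  exact (Matrix.isLowerTriangular_iff.2 h.1).eq_of_mul_transpose_eq (expDiag_isLowerTriangular M)
    h.2.1 (expDiag_pos M) h.2.2

theorem cholLog_cholInv (M : LowTri n) : cholLog (cholInv M) = M := by
  rw [cholLog, chol_cholInv, logDiag_expDiag]

theorem cholInv_mem_SPD (M : LowTri n) : cholInv M ∈ SPD n := by
  have h := Matrix.PosDef.one.mul_mul_conjTranspose_same (B := expDiag M)
    (Matrix.vecMul_injective_of_isUnit ((Matrix.isUnit_iff_isUnit_det _).2 (expDiag_isUnit_det M)))
  rwa [Matrix.mul_one, Matrix.conjTranspose_eq_transpose_of_trivial] at h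

theorem range_cholInv : range (cholInv (n := n)) = SPD n := by
  refine Subset.antisymm (range_subset_iff.2 cholInv_mem_SPD) fun S hS => ?_
  obtain ⟨L, hL, hd, h⟩ := Matrix.PosDef.exists_cholesky hS
  exact ⟨logDiag L, Subtype.ext (by simp only [cholInv, expDiag_logDiag hL hd, h])⟩

theorem cholInv_cholLog {P : SymMat n} (hP : P ∈ SPD n) : cholInv (cholLog P) = P := by
  obtain ⟨M, rfl⟩ := range_cholInv (n := n) ▸ hP
  rw [cholLog_cholInv]

theorem chol_eq_expDiag {P : SymMat n} (hP : P ∈ SPD n) : chol P = expDiag (cholLog P) := by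
  rw [← chol_cholInv, cholInv_cholLog hP]

theorem contDiff_lowTri_apply (i j : Fin n) :
    ContDiff ℝ ∞ (fun M : LowTri n => (M : Matrix (Fin n) (Fin n) ℝ) i j) :=
  ((Matrix.entryCLM i j).comp (LowTri n).subtypeL).contDiff

theorem contDiff_expDiag : ContDiff ℝ ∞ (expDiag (n := n)) := by
  refine contDiff_matrix fun i j => ?_
  by_cases h : i = j
  · subst h
    simp only [expDiag_apply_self]
    exact (contDiff_lowTri_apply i i).exp
  · simp only [expDiag_apply_ne _ h]
    exact contDiff_lowTri_apply i j

theorem hasFDerivAt_expDiag (M : LowTri n) : HasFDerivAt expDiag (fderiv ℝ expDiag M) M :=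
  (contDiff_expDiag.contDiffAt.differentiableAt (by simp)).hasFDerivAt

theorem fderiv_expDiag_apply (M V : LowTri n) (i j : Fin n) :
    fderiv ℝ expDiag M V i j =
      if i = j then expDiag M i j * (V : Matrix (Fin n) (Fin n) ℝ) i j
      else (V : Matrix (Fin n) (Fin n) ℝ) i j := by
  have h1 := (Matrix.entryCLM i j).hasFDerivAt.comp M (hasFDerivAt_expDiag M)
  have h0 := ((Matrix.entryCLM i j).comp (LowTri n).subtypeL).hasFDerivAt (x := M)
  split_ifs with h
  · subst h
    have h2 : (Matrix.entryCLM i i) ∘ expDiag = fun M : LowTri n =>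
        Real.exp (((Matrix.entryCLM i i).comp (LowTri n).subtypeL) M) :=
      funext fun M => expDiag_apply_self M i
    rw [h2] at h1
    have h3 := congrArg (fun T : LowTri n →L[ℝ] ℝ => T V) (h1.unique h0.exp)
    rw [expDiag_apply_self]
    exact h3
  · have h2 : (Matrix.entryCLM i j) ∘ expDiag = fun M : LowTri n =>
        ((Matrix.entryCLM i j).comp (LowTri n).subtypeL) M :=
      funext fun M => expDiag_apply_ne M h
    rw [h2] at h1
    exact congrArg (fun T : LowTri n →L[ℝ] ℝ => T V) (h1.unique h0)

theorem fderiv_expDiag_isLowerTriangular (M V : LowTri n) :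
    (fderiv ℝ expDiag M V).IsLowerTriangular :=
  Matrix.isLowerTriangular_iff.2 fun i j hij => by
    rw [fderiv_expDiag_apply, if_neg hij.ne, LowTri.apply_eq_zero V hij]

theorem contDiff_cholInv : ContDiff ℝ ∞ (cholInv (n := n)) := by
  refine contDiff_of_contDiff_coe (contDiff_matrix fun i j => ?_)
  simp only [cholInv, Matrix.mul_apply, Matrix.transpose_apply]
  have h : ∀ i j, ContDiff ℝ ∞ fun M : LowTri n => expDiag M i j := fun i j =>
    (Matrix.entryCLM i j).contDiff.comp contDiff_expDiag
  exact ContDiff.sum fun k _ => (h i k).mul (h j k)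

theorem hasFDerivAt_cholInv (M : LowTri n) : HasFDerivAt cholInv (fderiv ℝ cholInv M) M :=
  (contDiff_cholInv.contDiffAt.differentiableAt (by simp)).hasFDerivAt

theorem coe_fderiv_cholInv (M V : LowTri n) :
    (fderiv ℝ cholInv M V : Matrix (Fin n) (Fin n) ℝ) =
      fderiv ℝ expDiag M V * (expDiag M)ᵀ + expDiag M * (fderiv ℝ expDiag M V)ᵀ := by
  ext i j
  have h1 := ((Matrix.entryCLM i j).comp (SymMat n).subtypeL).hasFDerivAt.comp M
    (hasFDerivAt_cholInv M)
  have h : ∀ i j, HasFDerivAt (fun M : LowTri n => expDiag M i j)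
      ((Matrix.entryCLM i j).comp (fderiv ℝ expDiag M)) M := fun i j =>
    (Matrix.entryCLM i j).hasFDerivAt.comp M (hasFDerivAt_expDiag M)
  have h3 : ((Matrix.entryCLM i j).comp (SymMat n).subtypeL) ∘ cholInv =
      fun M : LowTri n => ∑ k, expDiag M i k * expDiag M j k := funext fun M => rfl
  rw [h3] at h1
  refine (h1.apply_eq_of_sum_mul (fun k => h i k) (fun k => h j k) V).trans ?_
  simp only [Matrix.add_apply, Matrix.mul_apply, Matrix.transpose_apply, ← Finset.sum_add_distrib]
  refine Finset.sum_congr rfl fun k _ => ?_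
  change expDiag M i k * fderiv ℝ expDiag M V j k + expDiag M j k * fderiv ℝ expDiag M V i k = _
  ring

/-- With `L = expDiag M` and `N` its derivative along `V`, the hypothesis reads `N Lᵀ + L Nᵀ = 0`.
Conjugating by `L⁻¹` makes `L⁻¹ N` skew-symmetric; being lower triangular as well, it is zero. -/
theorem fderiv_cholInv_injective (M V : LowTri n) (hV : fderiv ℝ cholInv M V = 0) : V = 0 := by
  have h := coe_fderiv_cholInv M V
  rw [hV] at h
  have hL := expDiag_isLowerTriangular M
  have hu := expDiag_isUnit_det M
  have hN := fderiv_expDiag_isLowerTriangular M V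
  have hNV := fderiv_expDiag_apply M V
  have hpos := expDiag_pos M
  set L := expDiag M
  set N := fderiv ℝ expDiag M V
  have hK := (hL.inv hu).mul hN
  have hKK : L⁻¹ * N + (L⁻¹ * N)ᵀ = 0 := by
    have h1 := congrArg (fun X => L⁻¹ * X * (L⁻¹)ᵀ) h
    simp only [Submodule.coe_zero, Matrix.mul_zero, Matrix.zero_mul, Matrix.mul_add,
      Matrix.add_mul] at h1
    rw [h1, ← Matrix.mul_assoc L⁻¹ L, Matrix.nonsing_inv_mul _ hu, Matrix.one_mul,
      ← Matrix.mul_assoc L⁻¹ N, Matrix.mul_assoc _ Lᵀ, ← Matrix.transpose_mul,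
      Matrix.nonsing_inv_mul _ hu, Matrix.transpose_one, Matrix.mul_one, Matrix.transpose_mul]
  have hK0 : L⁻¹ * N = 0 := by
    have h2 := (lowTriEquivSymMat n).map_eq_zero_iff
      (x := ⟨L⁻¹ * N, Matrix.isLowerTriangular_iff.1 hK⟩)
    exact congrArg Subtype.val (h2.1 (Subtype.ext hKK))
  have hN0 : N = 0 := by
    rw [← Matrix.mul_nonsing_inv_cancel_left _ N hu, hK0, Matrix.mul_zero]
  apply Subtype.ext
  ext i j
  have h3 := hNV i j
  rw [hN0] at h3
  split_ifs at h3 with hij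
  · subst hij
    exact (mul_eq_zero.1 h3.symm).resolve_left (hpos i).ne'
  · exact h3.symm

theorem contDiffOn_cholLog : ContDiffOn ℝ ∞ cholLog (SPD n) :=
  range_cholInv (n := n) ▸ (contDiff_cholInv.isOpen_range_and_contDiffOn_of_leftInverse
    (lowTriEquivSymMat n).finrank_eq fderiv_cholInv_injective cholLog_cholInv).2

theorem hasFDerivAt_cholLog {P : SymMat n} (hP : P ∈ SPD n) :
    HasFDerivAt cholLog (fderiv ℝ cholLog P) P :=
  ((contDiffOn_cholLog.contDiffAt (isOpen_SPD.mem_nhds hP)).differentiableAt (by simp)).hasFDerivAt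

theorem cholInv_zero : cholInv (0 : LowTri n) = symOne n :=
  Subtype.ext (by simp [cholInv, expDiag_zero, symOne])

/-- At the identity the inverse chart has differential `M ↦ M + Mᵀ`, which doubles the diagonal.
Inverting it is the source of the factor `1 / 2` in `lcmY`. -/
theorem coe_fderiv_cholLog_symOne (A : SymMat n) :
    (fderiv ℝ cholLog (symOne n) A : Matrix (Fin n) (Fin n) ℝ) = lcmY A := by
  have h1 := (hasFDerivAt_cholLog (symOne_mem_SPD (n := n)))
  rw [← cholInv_zero] at h1
  have h2 := h1.comp 0 (hasFDerivAt_cholInv 0)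
  have h3 : cholLog ∘ cholInv (n := n) = id := funext cholLog_cholInv
  rw [h3, cholInv_zero] at h2
  obtain ⟨M, rfl⟩ := (lowTriEquivSymMat n).surjective A
  have h4 : lowTriEquivSymMat n M = fderiv ℝ cholInv 0 M := by
    apply Subtype.ext
    have h5 : fderiv ℝ expDiag 0 M = (M : Matrix (Fin n) (Fin n) ℝ) := by
      ext i j
      rw [fderiv_expDiag_apply, expDiag_zero]
      split_ifs with h
      · subst h; simp
      · rfl
    rw [coe_fderiv_cholInv, h5, expDiag_zero, Matrix.transpose_one, Matrix.mul_one, Matrix.one_mul]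
    rfl
  have h6 : fderiv ℝ cholLog (symOne n) (fderiv ℝ cholInv 0 M) = M :=
    congrArg (fun T : LowTri n →L[ℝ] LowTri n => T M) (h2.unique (hasFDerivAt_id _))
  have h7 := (lowTriEquivSymMat n).symm_apply_apply M
  rw [h4, h6, ← h4]
  exact (congrArg Subtype.val h7).symm

/-! ### The Log-Cholesky metric -/

theorem lcForm_apply (L X Y : Matrix (Fin n) (Fin n) ℝ) : lcForm L X Y =
    (∑ i, ∑ j, if j < i then X i j * Y i j else 0) + ∑ j, X j j * Y j j * ((L j j) ^ 2)⁻¹ := rfl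

theorem fderiv_chol {P : SymMat n} (hP : P ∈ SPD n) (V : SymMat n) :
    fderiv ℝ chol P V = fderiv ℝ expDiag (cholLog P) (fderiv ℝ cholLog P V) := by
  have h1 := (hasFDerivAt_expDiag (cholLog P)).comp P (hasFDerivAt_cholLog hP)
  have h2 : chol =ᶠ[nhds P] expDiag ∘ cholLog := by
    filter_upwards [isOpen_SPD.mem_nhds hP] with Q hQ using chol_eq_expDiag hQ
  exact congrArg (fun T : SymMat n →L[ℝ] Matrix (Fin n) (Fin n) ℝ => T V)
    (h1.congr_of_eventuallyEq h2).fderiv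

/-- Differentiating the exponentials multiplies each diagonal entry by `L_jj`, which cancels the
weight `L_jj⁻²`. -/
theorem lcForm_fderiv_expDiag (M V W : LowTri n) :
    lcForm (expDiag M) (fderiv ℝ expDiag M V) (fderiv ℝ expDiag M W) =
      frob (V : Matrix (Fin n) (Fin n) ℝ) (W : Matrix (Fin n) (Fin n) ℝ) := by
  rw [lcForm_apply, frob, ← Finset.sum_add_distrib]
  refine Finset.sum_congr rfl fun i _ => ?_
  have h1 : fderiv ℝ expDiag M V i i * fderiv ℝ expDiag M W i i * ((expDiag M i i) ^ 2)⁻¹ =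
      ∑ j, if i = j then
        (V : Matrix (Fin n) (Fin n) ℝ) i j * (W : Matrix (Fin n) (Fin n) ℝ) i j else 0 := by
    have := (expDiag_pos M i).ne'
    simp only [Finset.sum_ite_eq, Finset.mem_univ, if_true, fderiv_expDiag_apply]
    field_simp
  rw [h1, ← Finset.sum_add_distrib]
  refine Finset.sum_congr rfl fun j _ => ?_
  rcases lt_trichotomy i j with h | rfl | h
  · simp [h.not_gt, h.ne, LowTri.apply_eq_zero V h]
  · simp
  · simp [h, h.ne', fderiv_expDiag_apply]

theorem lcMetric_eq {P : SymMat n} (hP : P ∈ SPD n) (V W : SymMat n) :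
    lcMetric n P V W = frob (fderiv ℝ cholLog P V : Matrix (Fin n) (Fin n) ℝ)
      (fderiv ℝ cholLog P W : Matrix (Fin n) (Fin n) ℝ) := by
  rw [← lcForm_fderiv_expDiag (cholLog P), ← fderiv_chol hP, ← fderiv_chol hP, ← chol_eq_expDiag hP]
  rfl

/-! ### Matrix powers and the deformed metric -/

theorem mpow_mem_SPD (θ : ℝ) {S : SymMat n} (hS : S ∈ SPD n) : mpow θ S ∈ SPD n := by
  rw [mpow_eq_symExp θ hS]
  exact symExp_mem_SPD _

theorem mpow_mpow_inv {θ : ℝ} (hθ : θ ≠ 0) {S : SymMat n} (hS : S ∈ SPD n) :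
    mpow θ (mpow θ⁻¹ S) = S := by
  rw [mpow_eq_symExp θ (mpow_mem_SPD _ hS), mpow_eq_symExp θ⁻¹ hS, mlog_symExp, smul_smul,
    mul_inv_cancel₀ hθ, one_smul, symExp_mlog hS]

theorem contDiffOn_mpow (θ : ℝ) : ContDiffOn ℝ ∞ (mpow θ) (SPD n) :=
  (contDiff_symExp.comp_contDiffOn ((θ • ContinuousLinearMap.id ℝ (SymMat n)).contDiff.comp_contDiffOn
    contDiffOn_mlog)).congr fun _ hS => mpow_eq_symExp θ hS

theorem hasFDerivAt_mpow (θ : ℝ) {P : SymMat n} (hP : P ∈ SPD n) :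
    HasFDerivAt (mpow θ) (fderiv ℝ (mpow θ) P) P :=
  (((contDiffOn_mpow θ).contDiffAt (isOpen_SPD.mem_nhds hP)).differentiableAt
    (by simp)).hasFDerivAt

theorem mpow_symOne (θ : ℝ) : mpow θ (symOne n) = symOne n := by
  rw [mpow_eq_symExp θ symOne_mem_SPD, mlog_symOne, smul_zero, symExp_zero]

/-- Near the identity the power is `exp ∘ (θ • ·) ∘ log`, and both `log` at `1` and `exp` at `0`
have the identity as differential. -/
theorem fderiv_mpow_symOne (θ : ℝ) (A : SymMat n) : fderiv ℝ (mpow θ) (symOne n) A = θ • A := by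
  have h1 : HasFDerivAt (fun S : SymMat n => θ • mlog S)
      (θ • ContinuousLinearMap.id ℝ (SymMat n)) (symOne n) :=
    (θ • ContinuousLinearMap.id ℝ (SymMat n)).hasFDerivAt.comp (symOne n) hasFDerivAt_mlog_symOne
  have h2 : HasFDerivAt symExp (fderiv ℝ symExp (0 : SymMat n)) (θ • mlog (symOne n)) := by
    rw [mlog_symOne, smul_zero]
    exact hasFDerivAt_symExp 0
  have h3 := h2.comp (symOne n) h1
  have h4 : mpow θ =ᶠ[nhds (symOne n)] symExp ∘ fun S : SymMat n => θ • mlog S := by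
    filter_upwards [isOpen_SPD.mem_nhds symOne_mem_SPD] with Q hQ using mpow_eq_symExp θ hQ
  rw [fderiv_symExp_zero] at h3
  exact congrArg (fun T : SymMat n →L[ℝ] SymMat n => T A) (h3.congr_of_eventuallyEq h4).fderiv

/-- The Frobenius inner product on lower triangular matrices. -/
noncomputable def frobLowTri (n : ℕ) : LinearMap.BilinForm ℝ (LowTri n) :=
  LinearMap.mk₂ ℝ
    (fun V W => frob (V : Matrix (Fin n) (Fin n) ℝ) (W : Matrix (Fin n) (Fin n) ℝ))
    (by intro V V' W
        simp only [frob, Submodule.coe_add, Matrix.add_apply, add_mul, Finset.sum_add_distrib])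
    (by intro c V W
        simp only [frob, Submodule.coe_smul, Matrix.smul_apply, smul_eq_mul, mul_assoc,
          ← Finset.mul_sum])
    (by intro V W W'
        simp only [frob, Submodule.coe_add, Matrix.add_apply, mul_add, Finset.sum_add_distrib])
    (by intro c V W
        simp only [frob, Submodule.coe_smul, Matrix.smul_apply, smul_eq_mul, mul_left_comm _ c,
          ← Finset.mul_sum])

theorem frobLowTri_apply (V W : LowTri n) : frobLowTri n V W =
    frob (V : Matrix (Fin n) (Fin n) ℝ) (W : Matrix (Fin n) (Fin n) ℝ) := rfl

theorem fderiv_cholLog_comp_mpow (θ : ℝ) {P : SymMat n} (hP : P ∈ SPD n) (V : SymMat n) :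
    fderiv ℝ (fun S => cholLog (mpow θ S)) P V =
      fderiv ℝ cholLog (mpow θ P) (fderiv ℝ (mpow θ) P V) := by
  have h := (hasFDerivAt_cholLog (mpow_mem_SPD θ hP)).comp P (hasFDerivAt_mpow θ hP)
  exact congrArg (fun T : SymMat n →L[ℝ] LowTri n => T V) h.fderiv

theorem flatChart_lcMetricDeformed {θ : ℝ} (hθ : θ ≠ 0) :
    OpenRiem.FlatChart (SPD n) (lcMetricDeformed n θ) (fun S => cholLog (mpow θ S))
      (fun M => mpow θ⁻¹ (cholInv M)) ((1 / θ ^ 2) • frobLowTri n) where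
  isOpen := isOpen_SPD
  contDiffOn := contDiffOn_cholLog.comp (contDiffOn_mpow θ) fun _ hS => mpow_mem_SPD θ hS
  contDiff_inv := contDiffOn_univ.1 ((contDiffOn_mpow θ⁻¹).comp contDiff_cholInv.contDiffOn
    fun M _ => cholInv_mem_SPD M)
  inv_mem M := mpow_mem_SPD _ (cholInv_mem_SPD M)
  left_inv P hP := by
    rw [cholInv_cholLog (mpow_mem_SPD θ hP)]
    simpa using mpow_mpow_inv (inv_ne_zero hθ) hP
  right_inv M := by rw [mpow_mpow_inv hθ (cholInv_mem_SPD M), cholLog_cholInv]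
  symm V W := by
    rw [LinearMap.smul_apply, LinearMap.smul_apply, LinearMap.smul_apply, LinearMap.smul_apply,
      frobLowTri_apply, frobLowTri_apply, frob_comm]
  posDef V hV := mul_pos (one_div_pos.2 (by positivity))
    (frob_self_pos fun h => hV (Subtype.ext h))
  metric P hP V W := by
    refine (congrArg (1 / θ ^ 2 * ·) (lcMetric_eq (mpow_mem_SPD θ hP) _ _)).trans ?_
    exact congrArg (1 / θ ^ 2 * ·) (congrArg₂ (fun X Y => frobLowTri n X Y)
      (fderiv_cholLog_comp_mpow θ hP V).symm (fderiv_cholLog_comp_mpow θ hP W).symm)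

theorem coe_cholLog_mpow_sub (θ : ℝ) (S P : SymMat n) :
    ((cholLog (mpow θ S) - cholLog (mpow θ P) : LowTri n) : Matrix (Fin n) (Fin n) ℝ) =
      lcmX θ S P := by
  simp only [Submodule.coe_sub, cholLog, logDiag, lcmX, dlog, diagPart, Matrix.diagonal_apply_eq]
  abel

/-- The differential of the power at the identity contributes one factor `θ`, leaving `θ / θ² = 1 /
θ`. -/
theorem form_chart_lcMetricDeformed {θ : ℝ} (hθ : θ ≠ 0) (S P A : SymMat n) :
    ((1 / θ ^ 2) • frobLowTri n) (cholLog (mpow θ S) - cholLog (mpow θ P))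
      (fderiv ℝ (fun S => cholLog (mpow θ S)) (symOne n) A) =
      1 / θ * frob (lcmX θ S P) (lcmY A) := by
  rw [fderiv_cholLog_comp_mpow θ symOne_mem_SPD, mpow_symOne, fderiv_mpow_symOne, map_smul,
    map_smul, LinearMap.smul_apply, LinearMap.smul_apply, frobLowTri_apply, coe_cholLog_mpow_sub,
    coe_fderiv_cholLog_symOne, smul_eq_mul, smul_eq_mul]
  field_simp

/-! ### The two regression formulas -/

theorem mainTheorem3 (n : ℕ) :
    (∀ α β : ℝ, 0 < min α (α + n * β) →
      OpenRiem.IsRiemannianMetric (SPD n) (lemMetric n α β) ∧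
      OpenRiem.HasLogAndTransport (SPD n) (lemMetric n α β) ∧
      ∀ (C : ℕ) (P A : Fin C → SymMat n), (∀ k, P k ∈ SPD n) → ∀ S ∈ SPD n, ∀ k : Fin C,
        rieMLR (SPD n) (lemMetric n α β) P
            (fun j => OpenRiem.transport (SPD n) (lemMetric n α β) (symOne n) (P j) (A j)) S k
          = softmax (fun j => innerAB n α β (mlog S - mlog (P j)) (A j)) k) ∧
    (∀ θ : ℝ, θ ≠ 0 →
      OpenRiem.IsRiemannianMetric (SPD n) (lcMetricDeformed n θ) ∧
      OpenRiem.HasLogAndTransport (SPD n) (lcMetricDeformed n θ) ∧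
      ∀ (C : ℕ) (P A : Fin C → SymMat n), (∀ k, P k ∈ SPD n) → ∀ S ∈ SPD n, ∀ k : Fin C,
        rieMLR (SPD n) (lcMetricDeformed n θ) P
            (fun j => OpenRiem.transport (SPD n) (lcMetricDeformed n θ) (symOne n) (P j) (A j)) S k
          = softmax (fun j => 1 / θ * frob (lcmX θ S (P j)) (lcmY (A j))) k) := by
  refine ⟨fun α β hαβ => ?_, fun θ hθ => ?_⟩
  · have h := flatChart_lemMetric hαβ
    refine ⟨h.isRiemannianMetric, h.hasLogAndTransport, fun C P A hP S hS k => ?_⟩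
    rw [h.rieMLR_transport symOne_mem_SPD hS hP]
    exact congrArg (fun s => softmax s k) (funext fun j => form_chart_lemMetric α β S (P j) (A j))
  · have h := flatChart_lcMetricDeformed (n := n) hθ
    refine ⟨h.isRiemannianMetric, h.hasLogAndTransport, fun C P A hP S hS k => ?_⟩
    rw [h.rieMLR_transport symOne_mem_SPD hS hP]
    exact congrArg (fun s => softmax s k)
      (funext fun j => form_chart_lcMetricDeformed hθ S (P j) (A j))
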